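/- For complex $a,q$ with $|q|<1$ let $(a;q)_n=\prod_{k=0}^{n-1}(1-aq^k)$, $(a;q)_\infty=\prod_{k\ge 0}(1-aq^k)$, and $$G(q)=\sum_{n\ge0}\frac{q^{n^2}}{(q;q)_n},\qquad H(q)=\sum_{n\ge0}\frac{q^{n(n+1)}}{(q;q)_n},\qquad \chi(q)=(-q;q^2)_\infty .$$ Let $$R(q)=\cfrac{q^{1/5}}{1+\cfrac{q}{1+\cfrac{q^2}{1+\cdots}}}$$ be the Rogers–Ramanujan continued fraction. Define \begin{align*} S&=G^2(q)H(q^2)G(q^3)H^2(q^4)H(q^{12}), & T&=H^2(q)G(q^2)H(q^3)G^2(q^4)G(q^{12}),\\ U&=G^3(q)H^3(q)H(q^6)-H^3(q^2)G(q^3)H(q^3), & V&=G^3(q)H^3(q)G(q^6)-G^3(q^2)G(q^3)H(q^3),\\ W&=H^3(q)G(q^6)H(q^6)-G^3(q^2)H^3(q^2)H(q^3), & X&=G^3(q)G(q^6)H(q^6)-G^3(q^2)H^3(q^2)G(q^3),\\ Y&=G^3(q^2)H(q^3)G(q^{12})-H^3(q)G^3(q^4)G(q^6), & Z&=H^3(q^2)G(q^3)H(q^{12})-G^3(q)H^3(q^4)H(q^6).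 \end{align*} **Theorem 1.4.** Let $q$ be a complex number with $|q|<1$, and let $q^{1/5}$ be any fifth root of $q$; write $q^{n/5}=(q^{1/5})^n$, and use this value of $(q^n)^{1/5}$ in $R(q^n)$. Then the continued fraction $1/(1+q/(1+q^2/(1+\cdots)))$ converges to a nonzero value, the denominators of the left-hand sides below do not vanish, and the following identities hold, where $q\neq0$ is assumed in all but the first: \begin{align*} \frac{H(q)H^2(q^3)G(q^{12})+qG(q)G^2(q^3)H(q^{12})}{G(q)G(q^3)H(q^6)G(q^{12})+q^2H(q)H(q^3)G(q^6)H(q^{12})}&=\frac{\chi(q^5)\chi(-q^{10})}{\chi(-q^6)\chi(q^{15})},\\ \frac{UG(q^2)H(q^3)G(q^{12})-qVH(q^2)G(q^3)H(q^{12})}{VH(q^2)H(q^6)G(q^{12})-q^2UG(q^2)G(q^6)H(q^{12})}&=\frac{\chi(q^5)\chi(-q^{10})}{\chi(-q^6)\chi(q^{15})},\\ \frac{WG(q)H(q^{12})G(q^{24})-q^2XH(q)G(q^{12})H(q^{24})}{q^4WG(q)G(q^6)H(q^{24})-XH(q)H(q^6)G(q^{24})}&=q^3\frac{\chi(q^{10})\chi(-q^{12})\chi(-q^{20})\chi(-q^{30})}{\chi^3(-q^{60})},\\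 \frac{SYH(q^{12})G(q^{24})-q^2TZG(q^{12})H(q^{24})}{TZH(q^6)G(q^{24})-q^4SYG(q^6)H(q^{24})}&=q^3\frac{\chi(q^{10})\chi(-q^{12})\chi(-q^{20})\chi(-q^{30})}{\chi^3(-q^{60})},\\ \frac{V}{q^{6/5}U}&=\frac{R(q)R(q^3)}{R^2(q^2)R(q^6)},\\ \frac{q^{3/5}W}{X}&=R^2(q)R(q^2)R(q^3)R(q^6),\\ \frac{Y}{q^3Z}&=\frac{R(q)}{R(q^2)R(q^4)}. \end{align*} -/

import Mathlib

open Filter Topology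

noncomputable section

namespace RogersRamanujan

/-- The finite `q`-Pochhammer symbol `(a;q)_n = ∏_{k<n} (1 - a q^k)`. -/
def qPoch (a q : ℂ) (n : ℕ) : ℂ := ∏ k ∈ Finset.range n, (1 - a * q ^ k)

/-- The infinite `q`-Pochhammer symbol `(a;q)_∞ = ∏_{k≥0} (1 - a q^k)`, for `|q| < 1`. -/
def qPochInf (a q : ℂ) : ℂ := ∏' k : ℕ, (1 - a * q ^ k)

/-- `χ(q) = (-q;q²)_∞`. -/
def chi (q : ℂ) : ℂ := qPochInf (-q) (q ^ 2)

/-- The Rogers–Ramanujan function `G(q) = ∑ q^{n²} / (q;q)_n`. -/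
def G (q : ℂ) : ℂ := ∑' n : ℕ, q ^ (n ^ 2) / qPoch q q n

/-- The Rogers–Ramanujan function `H(q) = ∑ q^{n(n+1)} / (q;q)_n`. -/
def H (q : ℂ) : ℂ := ∑' n : ℕ, q ^ (n * (n + 1)) / qPoch q q n

/-- The formal continued fraction `1/(1 + q/(1 + q²/(1 + q³/(1 + ⋯))))`:
integer part `0`, partial numerators `1, q, q², …`, partial denominators `1, 1, 1, …`. -/
def contFrac (q : ℂ) : GenContFract ℂ :=
  ⟨0, Stream'.Seq.ofStream fun n : ℕ => ⟨q ^ n, 1⟩⟩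

/-- The value of the continued fraction `1/(1 + q/(1 + q²/(1 + ⋯)))`,
the limit of its convergents. -/
def contFracValue (q : ℂ) : ℂ := limUnder atTop (contFrac q).convs

/-- The Rogers–Ramanujan continued fraction
`R(q) = q^{1/5}/(1 + q/(1 + q²/(1 + ⋯)))`, as a function of the chosen value `t` of `q^{1/5}`
(so `q = t^5`). With this choice `q^{n/5}` is `t^n`, and `R(q^n)` is `R (t^n)`. -/
def R (t : ℂ) : ℂ := t * contFracValue (t ^ 5)

def S (q : ℂ) : ℂ :=
  G q ^ 2 * H (q ^ 2) * G (q ^ 3) * H (q ^ 4) ^ 2 * H (q ^ 12)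

def T (q : ℂ) : ℂ :=
  H q ^ 2 * G (q ^ 2) * H (q ^ 3) * G (q ^ 4) ^ 2 * G (q ^ 12)

def U (q : ℂ) : ℂ :=
  G q ^ 3 * H q ^ 3 * H (q ^ 6) - H (q ^ 2) ^ 3 * G (q ^ 3) * H (q ^ 3)

def V (q : ℂ) : ℂ :=
  G q ^ 3 * H q ^ 3 * G (q ^ 6) - G (q ^ 2) ^ 3 * G (q ^ 3) * H (q ^ 3)

def W (q : ℂ) : ℂ :=
  H q ^ 3 * G (q ^ 6) * H (q ^ 6) - G (q ^ 2) ^ 3 * H (q ^ 2) ^ 3 * H (q ^ 3)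

def X (q : ℂ) : ℂ :=
  G q ^ 3 * G (q ^ 6) * H (q ^ 6) - G (q ^ 2) ^ 3 * H (q ^ 2) ^ 3 * G (q ^ 3)

def Y (q : ℂ) : ℂ :=
  G (q ^ 2) ^ 3 * H (q ^ 3) * G (q ^ 12) - H q ^ 3 * G (q ^ 4) ^ 3 * G (q ^ 6)

def Z (q : ℂ) : ℂ :=
  H (q ^ 2) ^ 3 * G (q ^ 3) * H (q ^ 12) - G q ^ 3 * H (q ^ 4) ^ 3 * H (q ^ 6)

end RogersRamanujan

end

/-! Write θ(x;p) = (x;p)_∞ (p/x;p)_∞. The Rogers–Ramanujan identities say G(q) = 1/θ(q;q⁵) and H(q)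
= 1/θ(q²;q⁵), and χ is a product by definition. The sums and differences in the theorem are products
too, because each is a common product times two terms of a three-term theta relation.

Both relations used specialize Weierstrass's `theta_three_term`. `theta_cubic` takes two of its four
parameters to be a primitive cube root of unity and 1; in base q⁵ or q¹⁰ it makes each of U, V, W,
X, Y, Z a monomial times a product. `theta_three_term_I` takes one parameter to be i; in base q¹⁵ or
q³⁰ it does the same for the numerators and denominators of the four quotients. What is left are
equalities between products of powers of (q^a;q^N)_∞. They hold once the exponents of 1 - q^n agree
for n over one period, a finite check (`prodVal_congr`).

The theta series and the Rogers–Ramanujan identities rest on finite sums. The q-binomial theorem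
gives a finite triple product, hence Jacobi's in the limit; the Bailey lemma, applied twice to the
unit pair, gives both Rogers–Ramanujan identities. Weierstrass's relation is the Plücker relation
for 2×2 determinants, since θ(ab)θ(a/b) is such a determinant up to a factor (`tsum_thetaTerm_mul`).
The numerators and denominators of the continued fraction obey one linear recurrence and tend to
H(q) and G(q), so R(q) = q^{1/5} H(q)/G(q), and the last three identities concern V/U, W/X and Y/Z
alone. -/

noncomputable section

namespace RogersRamanujan

/-! ### Finite and infinite q-Pochhammer symbols -/

section Pochhammer

variable {p : ℂ}

lemma qPoch_zero (a q : ℂ) : qPoch a q 0 = 1 := by simp [qPoch]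

lemma qPoch_succ (a q : ℂ) (n : ℕ) : qPoch a q (n + 1) = qPoch a q n * (1 - a * q ^ n) := by
  simp [qPoch, Finset.prod_range_succ]

lemma qPoch_succ' (a q : ℂ) (n : ℕ) : qPoch a q (n + 1) = (1 - a) * qPoch (a * q) q n := by
  simp only [qPoch, Finset.prod_range_succ', pow_zero, mul_one]
  rw [mul_comm]
  congr 1
  exact Finset.prod_congr rfl fun k _ => by ring

lemma qPoch_add (a q : ℂ) (m n : ℕ) :
    qPoch a q (m + n) = qPoch a q m * qPoch (a * q ^ m) q n := by
  simp only [qPoch, Finset.prod_range_add]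
  congr 1
  exact Finset.prod_congr rfl fun k _ => by ring

lemma pow_succ_ne_one (hp : ‖p‖ < 1) (n : ℕ) : p ^ (n + 1) ≠ 1 := by
  intro h
  have := pow_lt_one₀ (norm_nonneg p) hp n.succ_ne_zero
  rw [← norm_pow, h, norm_one] at this
  exact lt_irrefl _ this

lemma qPoch_self_ne_zero (hp : ‖p‖ < 1) (n : ℕ) : qPoch p p n ≠ 0 := by
  refine Finset.prod_ne_zero_iff.2 fun k _ => sub_ne_zero.2 ?_
  rw [← pow_succ']
  exact (pow_succ_ne_one hp k).symm

lemma summable_norm_mul_pow (a : ℂ) (hp : ‖p‖ < 1) : Summable fun k : ℕ => ‖-(a * p ^ k)‖ := by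
  simp only [norm_neg, norm_mul, norm_pow]
  exact (summable_geometric_of_lt_one (norm_nonneg _) hp).mul_left _

lemma multipliable_one_sub (a : ℂ) (hp : ‖p‖ < 1) : Multipliable fun k : ℕ => 1 - a * p ^ k := by
  simpa only [sub_eq_add_neg] using multipliable_one_add_of_summable (summable_norm_mul_pow a hp)

lemma tendsto_qPoch (a : ℂ) (hp : ‖p‖ < 1) :
    Tendsto (qPoch a p) atTop (𝓝 (qPochInf a p)) :=
  (multipliable_one_sub a hp).tendsto_prod_tprod_nat

lemma qPochInf_ne_zero {a : ℂ} (hp : ‖p‖ < 1) (h : ∀ k : ℕ, a * p ^ k ≠ 1) :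
    qPochInf a p ≠ 0 := by
  have := tprod_one_add_ne_zero_of_summable (f := fun k : ℕ => -(a * p ^ k))
    (fun k => by rw [← sub_eq_add_neg]; exact sub_ne_zero.2 (h k).symm)
    (summable_norm_mul_pow a hp)
  simpa only [qPochInf, sub_eq_add_neg] using this

lemma qPochInf_self_ne_zero (hp : ‖p‖ < 1) : qPochInf p p ≠ 0 :=
  qPochInf_ne_zero hp fun k => by rw [← pow_succ']; exact pow_succ_ne_one hp k

lemma qPochInf_eq_mul (a : ℂ) (hp : ‖p‖ < 1) :
    qPochInf a p = (1 - a) * qPochInf (a * p) p := by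
  have h1 := (tendsto_qPoch a hp).comp (tendsto_add_atTop_nat 1)
  have h2 := (tendsto_qPoch (a * p) hp).const_mul (1 - a)
  refine tendsto_nhds_unique h1 (h2.congr fun n => ?_)
  simp [qPoch_succ']

end Pochhammer

/-! ### The bilateral theta series -/

/-- The triangular exponent `r(r-1)/2`. -/
def tri (r : ℤ) : ℤ := r * (r - 1) / 2

lemma two_mul_tri (r : ℤ) : 2 * tri r = r * (r - 1) := by
  have h : (2 : ℤ) ∣ r * (r - 1) := (Int.even_mul_pred_self r).two_dvd
  rw [tri, Int.mul_ediv_cancel' h]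

lemma tri_succ (r : ℤ) : tri (r + 1) = tri r + r := by
  have h1 := two_mul_tri (r + 1)
  have h2 := two_mul_tri r
  linarith

lemma tri_zero : tri 0 = 0 := rfl

lemma tri_neg (r : ℤ) : tri (-r) = tri (r + 1) := by
  have h1 := two_mul_tri (r + 1)
  have h2 := two_mul_tri (-r)
  linarith

/-- The general term of the theta series. -/
def thetaTerm (p x : ℂ) (r : ℤ) : ℂ := (-1) ^ r * p ^ tri r * x ^ r

section Summability

lemma summable_nat_of_ratio {f : ℕ → ℂ} {p c : ℂ} (hp : ‖p‖ < 1) (h0 : ∀ n, f n ≠ 0)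
    (h : ∀ n, f (n + 1) = f n * (c * p ^ n)) : Summable f := by
  refine summable_of_ratio_test_tendsto_lt_one (l := 0) one_pos (.of_forall h0) ?_
  have : Tendsto (fun n : ℕ => ‖c‖ * ‖p‖ ^ n) atTop (𝓝 (‖c‖ * 0)) :=
    (tendsto_pow_atTop_nhds_zero_of_lt_one (norm_nonneg _) hp).const_mul _
  rw [mul_zero] at this
  refine this.congr fun n => ?_
  have := norm_ne_zero_iff.2 (h0 n)
  rw [h, norm_mul, norm_mul, norm_pow]
  field_simp

lemma summable_thetaTerm {p x : ℂ} (hp : ‖p‖ < 1) (hp0 : p ≠ 0) (hx : x ≠ 0) :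
    Summable (thetaTerm p x) := by
  have h1 : (-1 : ℂ) ≠ 0 := by norm_num
  have h0 : ∀ r, thetaTerm p x r ≠ 0 := fun r =>
    mul_ne_zero (mul_ne_zero (zpow_ne_zero _ h1) (zpow_ne_zero _ hp0)) (zpow_ne_zero _ hx)
  refine Summable.of_nat_of_neg (summable_nat_of_ratio (c := -x) hp (fun n => h0 _) fun n => ?_)
    (summable_nat_of_ratio (c := -x⁻¹ * p) hp (fun n => h0 _) fun n => ?_)
  · simp only [thetaTerm, Nat.cast_succ, tri_succ, zpow_add₀ hp0, zpow_add₀ hx, zpow_add₀ h1,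
      zpow_natCast, zpow_one]
    ring
  · have : tri (-((n + 1 : ℕ) : ℤ)) = tri (-(n : ℤ)) + (n + 1) := by
      rw [tri_neg, tri_neg]; push_cast; rw [tri_succ ((n : ℤ) + 1)]
    have e : (-((n + 1 : ℕ) : ℤ)) = -(n : ℤ) + -1 := by push_cast; ring
    simp only [thetaTerm, this]
    simp only [e, zpow_add₀ hp0, zpow_add₀ hx, zpow_add₀ h1, zpow_natCast, zpow_one,
      zpow_neg_one]
    norm_num
    ring

end Summability

/-! ### The q-binomial theorem and the q-Chu–Vandermonde sum -/

/-- The reciprocal `1/(p;p)_n`, extended by `0` to negative `n`. -/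
def invPoch (p : ℂ) (n : ℤ) : ℂ := if 0 ≤ n then (qPoch p p n.toNat)⁻¹ else 0

section InvPoch

variable {p : ℂ}

lemma invPoch_natCast (p : ℂ) (n : ℕ) : invPoch p n = (qPoch p p n)⁻¹ := by simp [invPoch]

lemma invPoch_zero (p : ℂ) : invPoch p 0 = 1 := by simp [invPoch, qPoch_zero]

lemma invPoch_of_neg (p : ℂ) {n : ℤ} (h : n < 0) : invPoch p n = 0 := by simp [invPoch, h]

lemma nonneg_of_invPoch_ne_zero {n : ℤ} (h : invPoch p n ≠ 0) : 0 ≤ n :=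
  not_lt.1 fun h' => h (invPoch_of_neg p h')

/-- Extension by 0 is consistent: at n = 0 the factor 1 - p^0 vanishes. This is why the sums below
can run over all integers without boundary terms. -/
lemma invPoch_sub_one (hp : ‖p‖ < 1) (n : ℤ) :
    invPoch p (n - 1) = (1 - p ^ n) * invPoch p n := by
  rcases lt_trichotomy n 0 with h | rfl | h
  · rw [invPoch_of_neg p h, invPoch_of_neg p (by omega), mul_zero]
  · rw [invPoch_of_neg p (by omega)]; simp
  · obtain ⟨m, rfl⟩ : ∃ m : ℕ, n = (m + 1 : ℕ) := ⟨(n - 1).toNat, by omega⟩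
    rw [show ((m + 1 : ℕ) : ℤ) - 1 = m by push_cast; ring, invPoch_natCast, invPoch_natCast,
      qPoch_succ, zpow_natCast, ← pow_succ']
    have h1 := qPoch_self_ne_zero hp m
    have h2 : 1 - p ^ (m + 1) ≠ 0 := sub_ne_zero.2 (pow_succ_ne_one hp m).symm
    field_simp

lemma tendsto_invPoch (hp : ‖p‖ < 1) {u : ℕ → ℤ} (hu : Tendsto u atTop atTop) :
    Tendsto (fun n => invPoch p (u n)) atTop (𝓝 (qPochInf p p)⁻¹) := by
  have h1 : Tendsto (fun n => (u n).toNat) atTop atTop :=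
    tendsto_atTop.2 fun b => (tendsto_atTop.1 hu b).mono fun n hn => by omega
  have h2 := ((tendsto_qPoch p hp).inv₀ (qPochInf_self_ne_zero hp)).comp h1
  refine h2.congr' ?_
  filter_upwards [tendsto_atTop.1 hu 0] with n hn
  simp [invPoch, hn]

lemma exists_norm_invPoch_le (hp : ‖p‖ < 1) : ∃ C, 0 ≤ C ∧ ∀ n, ‖invPoch p n‖ ≤ C := by
  obtain ⟨C, hC⟩ := ((tendsto_qPoch p hp).inv₀ (qPochInf_self_ne_zero hp)).norm.bddAbove_range
  have hC : ∀ n, ‖(qPoch p p n)⁻¹‖ ≤ C := fun n => hC ⟨n, rfl⟩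
  have h0 : 0 ≤ C := (norm_nonneg _).trans (hC 0)
  refine ⟨C, h0, fun n => ?_⟩
  unfold invPoch
  split_ifs
  · exact hC _
  · simpa using h0

lemma tsum_shift (f : ℤ → ℂ) (c : ℤ) : ∑' k : ℤ, f (k - c) = ∑' k : ℤ, f k :=
  (Equiv.subRight c).tsum_eq f

/-- Summability of a function vanishing off a finite interval of integers. -/
lemma summable_of_Icc {f : ℤ → ℂ} (a b : ℤ) (h : ∀ k, f k ≠ 0 → a ≤ k ∧ k ≤ b) : Summable f :=
  summable_of_hasFiniteSupport ((Set.finite_Icc a b).subset fun k hk => h k hk)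

/-- The `q`-binomial theorem. -/
lemma tsum_qBinomial (hp : ‖p‖ < 1) (hp0 : p ≠ 0) {z : ℂ} (hz : z ≠ 0) (m : ℕ) :
    ∑' k : ℤ, thetaTerm p z k * (invPoch p k * invPoch p (m - k)) =
      qPoch z p m * invPoch p m := by
  have hsupp : ∀ (m : ℕ) (c : ℤ → ℂ),
      Summable fun k : ℤ => c k * (invPoch p k * invPoch p (m - k)) := fun m c => by
    refine summable_of_Icc 0 m fun k hk => ?_
    have h1 := nonneg_of_invPoch_ne_zero (left_ne_zero_of_mul (right_ne_zero_of_mul hk))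
    have h2 := nonneg_of_invPoch_ne_zero (right_ne_zero_of_mul (right_ne_zero_of_mul hk))
    omega
  induction m with
  | zero =>
    rw [tsum_eq_single 0]
    · simp [thetaTerm, invPoch_zero, qPoch_zero, tri_zero]
    · intro k hk
      rcases lt_or_gt_of_ne hk with h | h
      · simp [invPoch_of_neg p h]
      · simp [invPoch_of_neg p (neg_lt_zero.2 h)]
  | succ m ih =>
    have hm : 1 - p ^ (m + 1) ≠ 0 := sub_ne_zero.2 (pow_succ_ne_one hp m).symm
    refine mul_left_cancel₀ hm ?_
    rw [← tsum_mul_left]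
    -- The q-Pascal rule: 1 - p^(m+1) = (1 - p^(m+1-k)) + p^(m+1-k) (1 - p^k). Each bracket lowers
    -- the index of one reciprocal, and the second part becomes the sum for m after a shift of k.
    have key : ∀ k : ℤ, (1 - p ^ (m + 1)) *
        (thetaTerm p z k * (invPoch p k * invPoch p ((m + 1 : ℕ) - k))) =
        thetaTerm p z k * (invPoch p k * invPoch p (m - k)) -
        z * p ^ m * (thetaTerm p z (k - 1) * (invPoch p (k - 1) * invPoch p (m - (k - 1)))) := by
      intro k
      have e1 := invPoch_sub_one hp ((m + 1 : ℕ) - k)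
      have e2 := invPoch_sub_one hp k
      rw [show (((m + 1 : ℕ) : ℤ) - k - 1) = m - k by push_cast; ring] at e1
      rw [show ((m : ℤ) - (k - 1)) = (m + 1 : ℕ) - k by push_cast; ring, e1, e2]
      have e3 : tri k = tri (k - 1) + (k - 1) := by rw [← tri_succ]; congr 1; ring
      obtain ⟨j, rfl⟩ : ∃ j, k = j + 1 := ⟨k - 1, by ring⟩
      have e4 : p ^ (((m + 1 : ℕ) : ℤ) - (j + 1)) = p ^ m / p ^ j := by
        rw [← zpow_natCast p m, ← zpow_sub₀ hp0]; congr 1; push_cast; ring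
      simp only [thetaTerm, e3, e4, add_sub_cancel_right, zpow_add₀ hp0, zpow_add₀ hz,
        zpow_add₀ (show (-1 : ℂ) ≠ 0 by norm_num), zpow_one]
      have := zpow_ne_zero j hp0
      field_simp
      ring
    rw [tsum_congr key, Summable.tsum_sub (hsupp m _) ?_, tsum_mul_left,
      tsum_shift
        (fun k : ℤ => thetaTerm p z k * (invPoch p k * invPoch p (m - k))) 1, ih]
    · have e1 := invPoch_sub_one hp (m + 1 : ℕ)
      rw [show (((m + 1 : ℕ) : ℤ) - 1) = m by push_cast; ring, zpow_natCast] at e1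
      rw [e1, qPoch_succ]
      ring
    · refine Summable.mul_left _ ?_
      exact (Equiv.subRight (1 : ℤ)).summable_iff.2 (hsupp m (thetaTerm p z))

/-- The `q`-Chu–Vandermonde sum behind the Bailey lemma. -/
lemma tsum_qVandermonde (hp : ‖p‖ < 1) (hp0 : p ≠ 0) (M : ℕ) (L : ℤ) :
    ∑' k : ℤ, p ^ (k ^ 2 + L * k) * (invPoch p (M - k) * invPoch p k * invPoch p (k + L)) =
      invPoch p M * invPoch p (M + L) := by
  have hsupp : ∀ (M : ℕ) (c d : ℤ → ℂ),
      Summable fun k : ℤ => c k * (invPoch p (M - k) * invPoch p k * d k) := fun M c d => by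
    refine summable_of_Icc 0 M fun k hk => ?_
    have h := left_ne_zero_of_mul (right_ne_zero_of_mul hk)
    have h1 := nonneg_of_invPoch_ne_zero (left_ne_zero_of_mul h)
    have h2 := nonneg_of_invPoch_ne_zero (right_ne_zero_of_mul h)
    omega
  -- The factor 1 - p^(M+1) is split as in the q-binomial theorem; the shift of k in the second part
  -- replaces L by L + 1.
  induction M generalizing L with
  | zero =>
    rw [tsum_eq_single 0]
    · simp [invPoch_zero]
    · intro k hk
      rcases lt_or_gt_of_ne hk with h | h
      · simp [invPoch_of_neg p h]
      · simp [invPoch_of_neg p (neg_lt_zero.2 h)]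
  | succ M ih =>
    have hM : 1 - p ^ (M + 1) ≠ 0 := sub_ne_zero.2 (pow_succ_ne_one hp M).symm
    refine mul_left_cancel₀ hM ?_
    rw [← tsum_mul_left]
    set F : ℤ → ℂ := fun k => p ^ (k ^ 2 + (L + 1) * k) *
      (invPoch p (M - k) * invPoch p k * invPoch p (k + (L + 1))) with hF
    have key : ∀ k : ℤ, (1 - p ^ (M + 1)) * (p ^ (k ^ 2 + L * k) *
        (invPoch p ((M + 1 : ℕ) - k) * invPoch p k * invPoch p (k + L))) =
        p ^ (k ^ 2 + L * k) * (invPoch p (M - k) * invPoch p k * invPoch p (k + L)) +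
        p ^ ((M : ℤ) + L + 1) * F (k - 1) := by
      intro k
      have e1 := invPoch_sub_one hp ((M + 1 : ℕ) - k)
      have e2 := invPoch_sub_one hp k
      rw [show (((M + 1 : ℕ) : ℤ) - k - 1) = M - k by push_cast; ring] at e1
      simp only [hF]
      rw [show ((M : ℤ) - (k - 1)) = (M + 1 : ℕ) - k by push_cast; ring, e1, e2,
        show k - 1 + (L + 1) = k + L by ring]
      have e4 : p ^ (k ^ 2 + L * k) * (1 - p ^ (M + 1)) =
          p ^ (k ^ 2 + L * k) * (1 - p ^ (((M + 1 : ℕ) : ℤ) - k)) +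
          p ^ ((M : ℤ) + L + 1) * p ^ ((k - 1) ^ 2 + (L + 1) * (k - 1)) * (1 - p ^ k) := by
        have a1 : p ^ ((M : ℤ) + L + 1) * p ^ ((k - 1) ^ 2 + (L + 1) * (k - 1)) =
            p ^ (k ^ 2 + L * k) * p ^ (((M + 1 : ℕ) : ℤ) - k) := by
          rw [← zpow_add₀ hp0, ← zpow_add₀ hp0]; congr 1; push_cast; ring
        have a2 : p ^ (((M + 1 : ℕ) : ℤ) - k) * p ^ k = p ^ (M + 1) := by
          rw [← zpow_add₀ hp0, ← zpow_natCast p (M + 1)]; congr 1; ring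
        rw [a1, ← a2]; ring
      linear_combination (invPoch p ((M + 1 : ℕ) - k) * invPoch p k * invPoch p (k + L)) * e4
    have hsF : Summable F := hsupp M _ fun k => invPoch p (k + (L + 1))
    rw [tsum_congr key, Summable.tsum_add (hsupp M _ fun k => invPoch p (k + L)) ?_,
      tsum_mul_left, tsum_shift F 1, ih, ih]
    · have e1 := invPoch_sub_one hp (M + 1 : ℕ)
      rw [show (((M + 1 : ℕ) : ℤ) - 1) = M by push_cast; ring, zpow_natCast] at e1
      have e2 := invPoch_sub_one hp (M + 1 + L)
      rw [show (M + 1 + L - 1 : ℤ) = M + L by ring] at e2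
      rw [e1, e2, show (M : ℤ) + (L + 1) = M + 1 + L by ring,
        show (M : ℤ) + L + 1 = M + 1 + L by ring]
      push_cast
      ring
    · exact Summable.mul_left _ ((Equiv.subRight (1 : ℤ)).summable_iff.2 hsF)

end InvPoch

/-! ### Jacobi's triple product -/

section TripleProduct

variable {p : ℂ}

/-- Reversal of factors: -x (1 - p^j/x) = p^j (1 - x p^(-j)) for j = 1, …, N. -/
lemma qPoch_mul_zpow_neg (hp0 : p ≠ 0) {x : ℂ} (hx : x ≠ 0) (N : ℕ) :
    (-1) ^ N * x ^ N * qPoch (p / x) p N = p ^ tri (N + 1) * qPoch (x * p ^ (-(N : ℤ))) p N := by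
  induction N with
  | zero => simp [qPoch_zero, tri]
  | succ N ih =>
    have e : x * p ^ (-((N + 1 : ℕ) : ℤ)) * p = x * p ^ (-(N : ℤ)) := by
      rw [mul_assoc, ← zpow_add_one₀ hp0]; congr 2; push_cast; ring
    rw [qPoch_succ' (x * _), e, qPoch_succ, tri_succ, zpow_add₀ hp0]
    have e2 : p ^ (((N + 1 : ℕ) : ℤ)) * (1 - x * p ^ (-((N + 1 : ℕ) : ℤ))) =
        -x * (1 - p / x * p ^ N) := by
      rw [zpow_neg, zpow_natCast]
      field_simp
      ring
    push_cast at *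
    linear_combination (-x * (1 - p / x * p ^ N)) * ih -
      (p ^ tri (N + 1) * qPoch (x * p ^ (-(N : ℤ))) p N) * e2

/-- The finite form of the Jacobi triple product. -/
lemma tsum_finite_tripleProduct (hp : ‖p‖ < 1) (hp0 : p ≠ 0) {x : ℂ} (hx : x ≠ 0) (n ε : ℕ) :
    ∑' r : ℤ, thetaTerm p x r * (invPoch p (n - r) * invPoch p (n + r + ε)) =
      qPoch x p n * qPoch (p / x) p (n + ε) * invPoch p (2 * n + ε : ℕ) := by
  have h1 : (-1 : ℂ) ≠ 0 := by norm_num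
  set N : ℕ := n + ε with hN
  -- The q-binomial theorem of order 2n + ε is centred by the shift k = r + N; this z makes
  -- (z;p)_{2n+ε} split into (z;p)_N (x;p)_n, whose first factor reverses to (p/x;p)_N.
  set z : ℂ := x * p ^ (-(N : ℤ)) with hz
  have hz0 : z ≠ 0 := mul_ne_zero hx (zpow_ne_zero _ hp0)
  have hb := tsum_qBinomial hp hp0 hz0 (2 * n + ε)
  rw [← tsum_shift _ (-N : ℤ)] at hb
  have hc : p ^ tri (N + 1) ≠ 0 := zpow_ne_zero _ hp0
  have hd : (-1 : ℂ) ^ N * x ^ N ≠ 0 := mul_ne_zero (pow_ne_zero _ h1) (pow_ne_zero _ hx)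
  refine mul_left_cancel₀ hd ?_
  have e1 : qPoch z p (2 * n + ε) = qPoch z p N * qPoch x p n := by
    rw [show 2 * n + ε = N + n by omega, qPoch_add]
    congr 2
    rw [hz, mul_assoc, ← zpow_natCast, ← zpow_add₀ hp0]
    simp
  rw [e1] at hb
  have e2 := qPoch_mul_zpow_neg hp0 hx N
  calc _ = p ^ tri (N + 1) * ∑' (k : ℤ), thetaTerm p z (k - -(N : ℤ)) *
        (invPoch p (k - -(N : ℤ)) * invPoch p ((2 * n + ε : ℕ) - (k - -(N : ℤ)))) := by
        rw [← tsum_mul_left, ← tsum_mul_left]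
        refine tsum_congr fun r => ?_
        rw [show r - -(N : ℤ) = n + r + ε by push_cast [hN]; ring,
          show ((2 * n + ε : ℕ) : ℤ) - (n + r + ε) = n - r by push_cast; ring]
        have : p ^ tri (N + 1) * thetaTerm p z (n + r + ε) =
            (-1) ^ N * x ^ N * thetaTerm p x r := by
          have e3 : tri (N + 1) + tri (n + r + ε) + -(N : ℤ) * (n + r + ε) = tri r := by
            have a1 := two_mul_tri (N + 1)
            have a2 := two_mul_tri (n + r + ε)
            have a3 := two_mul_tri r
            push_cast [hN] at *
            linarith
          rw [thetaTerm, thetaTerm, hz, mul_zpow, ← e3, zpow_add₀ hp0, zpow_add₀ hp0,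
            zpow_mul, show (n + r + ε : ℤ) = N + r by push_cast [hN]; ring, zpow_add₀ h1,
            zpow_add₀ hx, zpow_natCast, zpow_natCast]
          ring
        linear_combination -(invPoch p (n - r) * invPoch p (n + r + ε)) * this
    _ = _ := by
        rw [hb]
        linear_combination -(qPoch x p n * invPoch p (2 * n + ε : ℕ)) * e2

/-- The theta function `θ(x;p) = (x;p)_∞ (p/x;p)_∞`. -/
def theta (x p : ℂ) : ℂ := qPochInf x p * qPochInf (p / x) p

/-- Dominated convergence: the reciprocals 1/(p;p)_n are uniformly bounded. -/
lemma tendsto_tsum_invPoch (hp : ‖p‖ < 1) {c : ℤ → ℂ} (hc : Summable fun r => ‖c r‖) (ε : ℕ) :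
    Tendsto (fun n : ℕ => ∑' r : ℤ, c r * (invPoch p (n - r) * invPoch p (n + r + ε))) atTop
      (𝓝 (∑' r : ℤ, c r * ((qPochInf p p)⁻¹ * (qPochInf p p)⁻¹))) := by
  obtain ⟨C, hC0, hC⟩ := exists_norm_invPoch_le hp
  refine tendsto_tsum_of_dominated_convergence (hc.mul_right (C * C)) (fun r => ?_)
    (.of_forall fun n r => ?_)
  · refine ((tendsto_invPoch hp ?_).mul (tendsto_invPoch hp ?_)).const_mul _
    · exact tendsto_atTop_add_const_right _ (-r) tendsto_natCast_atTop_atTop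
    · simp only [add_assoc]
      exact tendsto_atTop_add_const_right _ (r + ε : ℤ) tendsto_natCast_atTop_atTop
  · rw [norm_mul, norm_mul]
    gcongr <;> exact hC _

/-- The Jacobi triple product identity. -/
theorem tsum_thetaTerm (hp : ‖p‖ < 1) (hp0 : p ≠ 0) {x : ℂ} (hx : x ≠ 0) :
    ∑' r : ℤ, thetaTerm p x r = qPochInf p p * theta x p := by
  have h1 := tendsto_tsum_invPoch hp (summable_thetaTerm hp hp0 hx).norm 0
  have h2 : Tendsto (fun n : ℕ => qPoch x p n * qPoch (p / x) p n * invPoch p (2 * n : ℕ)) atTop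
      (𝓝 (qPochInf x p * qPochInf (p / x) p * (qPochInf p p)⁻¹)) := by
    refine ((tendsto_qPoch x hp).mul (tendsto_qPoch _ hp)).mul (tendsto_invPoch hp ?_)
    exact tendsto_natCast_atTop_atTop.comp (tendsto_id.const_mul_atTop' two_pos)
  have h3 := tendsto_nhds_unique (h1.congr fun n => ?_) h2
  · rw [tsum_mul_right] at h3
    have := qPochInf_self_ne_zero hp
    rw [theta]
    field_simp at h3
    linear_combination h3
  · simpa using tsum_finite_tripleProduct hp hp0 hx n 0

end TripleProduct

/-! ### The Bailey lemma and the Rogers–Ramanujan identities -/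

section Bailey

variable {p : ℂ}

/-- The limiting Bailey lemma, relative to `a = p ^ ε`. -/
lemma bailey (hp : ‖p‖ < 1) (hp0 : p ≠ 0) {ε : ℕ} (hε : ε ≤ 1) (α : ℤ → ℂ) (n : ℕ) :
    ∑' r : ℤ, α r * p ^ (r ^ 2 + ε * r) * (invPoch p (n - r) * invPoch p (n + r + ε)) =
      ∑' s : ℤ, p ^ (s ^ 2 + ε * s) * invPoch p (n - s) *
        ∑' r : ℤ, α r * (invPoch p (s - r) * invPoch p (s + r + ε)) := by
  have hr : ∀ r : ℤ, α r * p ^ (r ^ 2 + ε * r) * (invPoch p (n - r) * invPoch p (n + r + ε)) =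
      ∑' s : ℤ, p ^ (s ^ 2 + ε * s) * invPoch p (n - s) *
        (α r * (invPoch p (s - r) * invPoch p (s + r + ε))) := by
    intro r
    by_cases hrn : r ≤ n
    · obtain ⟨M, hM⟩ : ∃ M : ℕ, n - r = (M : ℤ) := ⟨(n - r).toNat, by omega⟩
      -- Vandermonde with M = n - r and L = 2r + ε expands the kernel in s; completing the square,
      -- r² + εr + (s-r)² + (2r+ε)(s-r) = s² + εs. The lemma is then an exchange of finite sums.
      have hv := tsum_qVandermonde hp hp0 M (2 * r + ε)
      rw [← tsum_shift _ r] at hv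
      rw [hM, show (n + r + ε : ℤ) = M + (2 * r + ε) by rw [← hM]; ring, ← hv, ← tsum_mul_left]
      refine tsum_congr fun s => ?_
      rw [show (M : ℤ) - (s - r) = n - s by rw [← hM]; ring,
        show s - r + (2 * r + ε) = s + r + ε by ring]
      have : p ^ (r ^ 2 + ε * r) * p ^ ((s - r) ^ 2 + (2 * r + ε) * (s - r)) =
          p ^ (s ^ 2 + ε * s) := by
        rw [← zpow_add₀ hp0]; congr 1; ring
      linear_combination α r * (invPoch p (n - s) * invPoch p (s - r) * invPoch p (s + r + ε))
        * this
    · rw [invPoch_of_neg p (show (n : ℤ) - r < 0 by omega)]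
      rw [tsum_congr (g := fun _ => (0 : ℂ)), tsum_zero]
      · simp
      · intro s
        by_cases hs : s < r
        · simp [invPoch_of_neg p (show s - r < 0 by omega)]
        · simp [invPoch_of_neg p (show (n : ℤ) - s < 0 by omega)]
  rw [tsum_congr hr, Summable.tsum_comm]
  · exact tsum_congr fun s => tsum_mul_left
  · refine summable_of_hasFiniteSupport
      (((Set.finite_Icc (-n - 1 : ℤ) n).prod (Set.finite_Icc (-n - 1 : ℤ) n)).subset ?_)
    rintro ⟨s, r⟩ h
    simp only [Function.mem_support, Function.uncurry_apply_pair] at h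
    have h1 := nonneg_of_invPoch_ne_zero (right_ne_zero_of_mul (left_ne_zero_of_mul h))
    have h2 := right_ne_zero_of_mul (right_ne_zero_of_mul h)
    have h3 := nonneg_of_invPoch_ne_zero (left_ne_zero_of_mul h2)
    have h4 := nonneg_of_invPoch_ne_zero (right_ne_zero_of_mul h2)
    simp only [Set.mem_prod, Set.mem_Icc]
    omega

/-- The unit Bailey pair. -/
lemma tsum_unitPair (hp : ‖p‖ < 1) (hp0 : p ≠ 0) {ε : ℕ} (hε : ε ≤ 1) (s : ℤ) :
    ∑' r : ℤ, thetaTerm p 1 r * (invPoch p (s - r) * invPoch p (s + r + ε)) =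
      if s = 0 then 1 else 0 := by
  rcases lt_or_ge s 0 with hs | hs
  · rw [if_neg hs.ne, tsum_congr (g := fun _ => (0 : ℂ)), tsum_zero]
    intro r
    by_cases hr : s < r
    · simp [invPoch_of_neg p (show s - r < 0 by omega)]
    · simp [invPoch_of_neg p (show s + r + ε < 0 by omega)]
  · obtain ⟨n, rfl⟩ := Int.eq_ofNat_of_zero_le hs
    -- At x = 1 the product contains (1;p)_n, which vanishes unless n = 0.
    rw [tsum_finite_tripleProduct hp hp0 one_ne_zero, div_one]
    cases n with
    | zero =>
      simp only [qPoch_zero, mul_zero, zero_add, invPoch_natCast, one_mul]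
      simpa using mul_inv_cancel₀ (qPoch_self_ne_zero hp ε)
    | succ n =>
      rw [qPoch_succ']
      simp
      omega

/-- Two Bailey steps from the unit pair: in the inner one only the index 0 survives, leaving the
single factor 1/(p;p)_s. -/
lemma tsum_iterated_bailey (hp : ‖p‖ < 1) (hp0 : p ≠ 0) {ε : ℕ} (hε : ε ≤ 1) (n : ℕ) :
    ∑' r : ℤ, thetaTerm p 1 r * p ^ (r ^ 2 + ε * r) * p ^ (r ^ 2 + ε * r) *
        (invPoch p (n - r) * invPoch p (n + r + ε)) =
      ∑' s : ℤ, p ^ (s ^ 2 + ε * s) * invPoch p (n - s) * invPoch p s := by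
  rw [bailey hp hp0 hε]
  refine tsum_congr fun s => ?_
  rcases lt_or_ge s 0 with hs | hs
  · rw [invPoch_of_neg p hs, tsum_congr (g := fun _ => (0 : ℂ)), tsum_zero]
    intro r
    by_cases hr : s < r
    · simp [invPoch_of_neg p (show s - r < 0 by omega)]
    · simp [invPoch_of_neg p (show s + r + ε < 0 by omega)]
  · obtain ⟨m, rfl⟩ := Int.eq_ofNat_of_zero_le hs
    rw [bailey hp hp0 hε, tsum_eq_single 0]
    · rw [tsum_unitPair hp hp0 hε]; simp
    · intro k hk
      rw [tsum_unitPair hp hp0 hε, if_neg hk, mul_zero]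

lemma summable_zpow_sq (hp : ‖p‖ < 1) (hp0 : p ≠ 0) (c : ℤ) :
    Summable fun s : ℤ => ‖p ^ (s ^ 2 + c * s)‖ := by
  have hp2 : ‖p ^ 2‖ < 1 := by
    rw [norm_pow]; exact pow_lt_one₀ (norm_nonneg _) hp two_ne_zero
  refine (summable_thetaTerm hp2 (pow_ne_zero 2 hp0)
    (zpow_ne_zero (1 + c) hp0)).norm.congr fun s => ?_
  have : thetaTerm (p ^ 2) (p ^ (1 + c)) s = (-1) ^ s * p ^ (s ^ 2 + c * s) := by
    rw [thetaTerm, ← zpow_natCast p 2, ← zpow_mul, ← zpow_mul, mul_assoc, ← zpow_add₀ hp0]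
    congr 2
    have := two_mul_tri s
    push_cast
    linarith
  rw [this, norm_mul, norm_zpow]
  simp

/-- Both Rogers–Ramanujan identities, before product form. -/
lemma rogersRamanujan_aux (hp : ‖p‖ < 1) (hp0 : p ≠ 0) {ε : ℕ} (hε : ε ≤ 1) :
    qPochInf p p * ∑' n : ℕ, p ^ (n ^ 2 + ε * n) / qPoch p p n =
      qPochInf (p ^ 5) (p ^ 5) * theta (p ^ (2 + 2 * ε)) (p ^ 5) := by
  have hp5 : ‖p ^ 5‖ < 1 := by
    rw [norm_pow]; exact pow_lt_one₀ (norm_nonneg _) hp (by norm_num)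
  have hx : p ^ (2 + 2 * ε) ≠ 0 := pow_ne_zero _ hp0
  have hP := qPochInf_self_ne_zero hp
  -- The exponents add up as r(r-1)/2 + 2(r² + εr) = 5 r(r-1)/2 + (2+2ε) r, a theta series in base
  -- p⁵.
  have hterm : ∀ r : ℤ, thetaTerm p 1 r * p ^ (r ^ 2 + ε * r) * p ^ (r ^ 2 + ε * r) =
      thetaTerm (p ^ 5) (p ^ (2 + 2 * ε)) r := by
    intro r
    simp only [thetaTerm, one_zpow, mul_one]
    rw [← zpow_natCast p 5, ← zpow_natCast p (2 + 2 * ε), ← zpow_mul, ← zpow_mul, mul_assoc,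
      mul_assoc, mul_assoc, ← zpow_add₀ hp0, ← zpow_add₀ hp0, ← zpow_add₀ hp0]
    congr 2
    have := two_mul_tri r
    push_cast
    linarith
  have hs := summable_thetaTerm hp5 (pow_ne_zero 5 hp0) hx
  have h1 := tendsto_tsum_invPoch hp hs.norm ε
  obtain ⟨C, hC0, hC⟩ := exists_norm_invPoch_le hp
  have h2 : Tendsto (fun n : ℕ => ∑' s : ℤ, p ^ (s ^ 2 + ε * s) * invPoch p (n - s) * invPoch p s)
      atTop (𝓝 (∑' s : ℤ, p ^ (s ^ 2 + ε * s) * (qPochInf p p)⁻¹ * invPoch p s)) := by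
    refine tendsto_tsum_of_dominated_convergence
      (((summable_zpow_sq hp hp0 ε).mul_right C).mul_right C) (fun s => ?_)
      (.of_forall fun n s => ?_)
    · refine ((tendsto_invPoch hp ?_).const_mul _).mul_const _
      exact tendsto_atTop_add_const_right _ (-s) tendsto_natCast_atTop_atTop
    · rw [norm_mul, norm_mul]
      gcongr <;> exact hC _
  have h3 := tendsto_nhds_unique (h1.congr fun n => ?_) h2
  · rw [tsum_mul_right, tsum_thetaTerm hp5 (pow_ne_zero 5 hp0) hx] at h3
    have h4 : ∑' s : ℤ, p ^ (s ^ 2 + ε * s) * (qPochInf p p)⁻¹ * invPoch p s =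
        (qPochInf p p)⁻¹ * ∑' n : ℕ, p ^ (n ^ 2 + ε * n) / qPoch p p n := by
      rw [← tsum_mul_left, ← Function.Injective.tsum_eq (Nat.cast_injective (R := ℤ))]
      · refine tsum_congr fun n => ?_
        rw [invPoch_natCast, show (n : ℤ) ^ 2 + ε * n = (n ^ 2 + ε * n : ℕ) by push_cast; ring,
          zpow_natCast]
        ring
      · intro s hs
        have := nonneg_of_invPoch_ne_zero (right_ne_zero_of_mul hs)
        exact ⟨s.toNat, by simp [this]⟩
    rw [h4] at h3
    field_simp at h3
    linear_combination -h3
  · rw [← tsum_iterated_bailey hp hp0 hε]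
    exact tsum_congr fun r => by rw [hterm]

end Bailey

/-! ### Weierstrass's three-term relation and its specializations -/

section Weierstrass

variable {p : ℂ}

/-- The even part of the theta series in the addition formula. -/
def evenTheta (p x : ℂ) : ℂ := ∑' k : ℤ, p ^ (k ^ 2) * x ^ (2 * k)

/-- The odd part of the theta series in the addition formula. -/
def oddTheta (p x : ℂ) : ℂ := ∑' k : ℤ, p ^ (k ^ 2 + k) * x ^ (2 * k + 1)

/-- Pairs of integers as sums and differences. -/
def sumDiff : (ℤ × ℤ) ⊕ (ℤ × ℤ) → ℤ × ℤ
  | .inl u => (u.1 + u.2, u.1 - u.2)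
  | .inr u => (u.1 + u.2 + 1, u.1 - u.2)

lemma sumDiff_bijective : Function.Bijective sumDiff := by
  constructor
  · rintro (⟨a, b⟩ | ⟨a, b⟩) (⟨c, d⟩ | ⟨c, d⟩) h <;>
      simp only [sumDiff, Prod.mk.injEq, Sum.inl.injEq, Sum.inr.injEq, reduceCtorEq] at h ⊢ <;>
      omega
  · rintro ⟨m, n⟩
    rcases Int.even_or_odd' (m + n) with ⟨k, hk | hk⟩
    · exact ⟨.inl (k, m - k), by simp only [sumDiff, Prod.mk.injEq]; omega⟩
    · exact ⟨.inr (k, m - k - 1), by simp only [sumDiff, Prod.mk.injEq]; omega⟩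

lemma summable_norm_even (hp : ‖p‖ < 1) (hp0 : p ≠ 0) {x : ℂ} (hx : x ≠ 0) (c : ℤ) :
    Summable fun k : ℤ => ‖p ^ (k ^ 2 + c * k) * x ^ (2 * k)‖ := by
  have hp2 : ‖p ^ 2‖ < 1 := by
    rw [norm_pow]; exact pow_lt_one₀ (norm_nonneg _) hp two_ne_zero
  refine (summable_thetaTerm hp2 (pow_ne_zero 2 hp0)
    (mul_ne_zero (zpow_ne_zero (1 + c) hp0) (pow_ne_zero 2 hx))).norm.congr fun s => ?_
  have : thetaTerm (p ^ 2) (p ^ (1 + c) * x ^ 2) s =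
      (-1) ^ s * (p ^ (s ^ 2 + c * s) * x ^ (2 * s)) := by
    have e : s ^ 2 + c * s = ((2 : ℕ) : ℤ) * tri s + (1 + c) * s := by
      have := two_mul_tri s
      push_cast
      linarith
    rw [thetaTerm, e, zpow_add₀ hp0 (_ * _), zpow_mul, mul_zpow, zpow_mul p (1 + c), zpow_mul x,
      zpow_natCast]
    norm_cast
    ring
  rw [this, norm_mul, norm_zpow]
  simp

lemma mul_oddTheta {x : ℂ} (hx : x ≠ 0) :
    x * oddTheta p x = ∑' k : ℤ, p ^ (k ^ 2 - k) * x ^ (2 * k) := by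
  rw [oddTheta, ← tsum_mul_left, ← tsum_shift _ 1]
  refine tsum_congr fun k => ?_
  rw [mul_left_comm, ← zpow_one_add₀ hx]
  congr 2 <;> ring

/-- The addition formula for products of two theta functions. -/
lemma tsum_thetaTerm_mul (hp : ‖p‖ < 1) (hp0 : p ≠ 0) {x y : ℂ} (hx : x ≠ 0) (hy : y ≠ 0) :
    (∑' r, thetaTerm p (x * y) r) * ∑' r, thetaTerm p (x / y) r =
      x * (oddTheta p x * evenTheta p y - evenTheta p x * oddTheta p y) := by
  have h1 : (-1 : ℂ) ≠ 0 := by norm_num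
  have s1 := (summable_thetaTerm hp hp0 (mul_ne_zero hx hy)).norm
  have s2 := (summable_thetaTerm hp hp0 (div_ne_zero hx hy)).norm
  have sm := summable_norm_even hp hp0 hx (-1)
  have s0 := fun {z : ℂ} (hz : z ≠ 0) => summable_norm_even hp hp0 hz 0
  have sp := (summable_norm_even hp hp0 hy 1).mul_right ‖y‖
  have hl : ∀ k l : ℤ, thetaTerm p (x * y) (k + l) * thetaTerm p (x / y) (k - l) =
      (p ^ (k ^ 2 + -1 * k) * x ^ (2 * k)) * (p ^ (l ^ 2 + 0 * l) * y ^ (2 * l)) := by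
    intro k l
    have e : tri (k + l) + tri (k - l) = (k ^ 2 + -1 * k) + (l ^ 2 + 0 * l) := by
      have a1 := two_mul_tri (k + l)
      have a2 := two_mul_tri (k - l)
      linarith
    have e1 : (-1 : ℂ) ^ (k + l) * (-1) ^ (k - l) = 1 := by
      rw [← zpow_add₀ h1, show k + l + (k - l) = 2 * k by ring, zpow_mul]; simp
    have e2 : p ^ tri (k + l) * p ^ tri (k - l) = p ^ (k ^ 2 + -1 * k) * p ^ (l ^ 2 + 0 * l) := by
      rw [← zpow_add₀ hp0, e, zpow_add₀ hp0]
    have e3 : (x * y) ^ (k + l) * (x / y) ^ (k - l) = x ^ (2 * k) * y ^ (2 * l) := by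
      rw [mul_zpow, div_zpow, div_eq_mul_inv, ← zpow_neg,
        show 2 * k = (k + l) + (k - l) by ring, show 2 * l = (k + l) + -(k - l) by ring,
        zpow_add₀ hx (k + l) (k - l), zpow_add₀ hy (k + l) (-(k - l))]
      ring
    calc _ = ((-1 : ℂ) ^ (k + l) * (-1) ^ (k - l)) * (p ^ tri (k + l) * p ^ tri (k - l)) *
          ((x * y) ^ (k + l) * (x / y) ^ (k - l)) := by unfold thetaTerm; ring
      _ = _ := by rw [e1, e2, e3]; ring
  have hr : ∀ k l : ℤ, thetaTerm p (x * y) (k + l + 1) * thetaTerm p (x / y) (k - l) =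
      -x * ((p ^ (k ^ 2 + 0 * k) * x ^ (2 * k)) * (p ^ (l ^ 2 + 1 * l) * y ^ (2 * l) * y)) := by
    intro k l
    have e : tri (k + l + 1) + tri (k - l) = (k ^ 2 + 0 * k) + (l ^ 2 + 1 * l) := by
      have a1 := two_mul_tri (k + l + 1)
      have a2 := two_mul_tri (k - l)
      linarith
    have e1 : (-1 : ℂ) ^ (k + l + 1) * (-1) ^ (k - l) = -1 := by
      rw [← zpow_add₀ h1, show k + l + 1 + (k - l) = 2 * k + 1 by ring, zpow_add₀ h1, zpow_mul]
      simp
    have e2 : p ^ tri (k + l + 1) * p ^ tri (k - l) =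
        p ^ (k ^ 2 + 0 * k) * p ^ (l ^ 2 + 1 * l) := by
      rw [← zpow_add₀ hp0, e, zpow_add₀ hp0]
    have e3 : (x * y) ^ (k + l + 1) * (x / y) ^ (k - l) =
        x ^ (2 * k) * x * (y ^ (2 * l) * y) := by
      rw [← zpow_add_one₀ hx, ← zpow_add_one₀ hy, mul_zpow, div_zpow, div_eq_mul_inv, ← zpow_neg,
        show 2 * k + 1 = (k + l + 1) + (k - l) by ring,
        show 2 * l + 1 = (k + l + 1) + -(k - l) by ring, zpow_add₀ hx (k + l + 1) (k - l),
        zpow_add₀ hy (k + l + 1) (-(k - l))]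
      ring
    calc _ = ((-1 : ℂ) ^ (k + l + 1) * (-1) ^ (k - l)) *
          (p ^ tri (k + l + 1) * p ^ tri (k - l)) *
          ((x * y) ^ (k + l + 1) * (x / y) ^ (k - l)) := by unfold thetaTerm; ring
      _ = _ := by rw [e1, e2, e3]; ring
  have sp' : Summable fun l : ℤ => ‖p ^ (l ^ 2 + 1 * l) * y ^ (2 * l) * y‖ :=
    sp.congr fun l => (norm_mul _ _).symm
  -- The double series is split by the parity of the sum of its indices; on each class, sum and
  -- difference coordinates separate x from y.
  rw [tsum_mul_tsum_of_summable_norm s1 s2, ← (Equiv.ofBijective _ sumDiff_bijective).tsum_eq,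
    Summable.tsum_sum]
  · simp only [Equiv.ofBijective_apply, sumDiff, hl, hr]
    rw [tsum_mul_left, ← tsum_mul_tsum_of_summable_norm sm (s0 hy),
      ← tsum_mul_tsum_of_summable_norm (s0 hx) sp']
    have e1 : ∑' k : ℤ, p ^ (k ^ 2 + -1 * k) * x ^ (2 * k) = x * oddTheta p x := by
      rw [mul_oddTheta hx]
      exact tsum_congr fun k => by rw [neg_one_mul, ← sub_eq_add_neg]
    have e2 : ∀ z, ∑' k : ℤ, p ^ (k ^ 2 + 0 * k) * z ^ (2 * k) = evenTheta p z := fun z =>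
      tsum_congr fun k => by rw [zero_mul, add_zero]
    have e3 : ∑' k : ℤ, p ^ (k ^ 2 + 1 * k) * y ^ (2 * k) * y = oddTheta p y :=
      tsum_congr fun k => by rw [one_mul, mul_assoc, ← zpow_add_one₀ hy]
    rw [e1, e2, e2, e3]
    ring
  · exact (summable_mul_of_summable_norm sm (s0 hy)).congr fun u => (hl u.1 u.2).symm
  · exact ((summable_mul_of_summable_norm (s0 hx) sp').mul_left (-x)).congr
      fun u => (hr u.1 u.2).symm

lemma norm_pow_lt_one (hp : ‖p‖ < 1) {n : ℕ} (hn : n ≠ 0) : ‖p ^ n‖ < 1 := by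
  rw [norm_pow]; exact pow_lt_one₀ (norm_nonneg _) hp hn

/-- Weierstrass's three-term relation. -/
theorem theta_three_term (hp : ‖p‖ < 1) (hp0 : p ≠ 0) {x y u v : ℂ} (hx : x ≠ 0) (hy : y ≠ 0)
    (hu : u ≠ 0) (hv : v ≠ 0) :
    y * (theta (x * y) p * theta (x / y) p) * (theta (u * v) p * theta (u / v) p) -
      u * (theta (x * u) p * theta (x / u) p) * (theta (y * v) p * theta (y / v) p) +
      u * (theta (x * v) p * theta (x / v) p) * (theta (y * u) p * theta (y / u) p) = 0 := by
  have hP := qPochInf_self_ne_zero hp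
  -- Each factor is a times the determinant of the vectors (odd, even) at a and b. All three terms
  -- then carry the common factor xyu, and the Plücker relation remains.
  have key : ∀ {a b : ℂ}, a ≠ 0 → b ≠ 0 → theta (a * b) p * theta (a / b) p =
      a * (oddTheta p a * evenTheta p b - evenTheta p a * oddTheta p b) /
        qPochInf p p ^ 2 := by
    intro a b ha hb
    have h := tsum_thetaTerm_mul hp hp0 ha hb
    rw [tsum_thetaTerm hp hp0 (mul_ne_zero ha hb), tsum_thetaTerm hp hp0 (div_ne_zero ha hb)] at h
    rw [← h]
    field_simp
  rw [key hx hy, key hu hv, key hx hu, key hy hv, key hx hv, key hy hu]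
  ring

lemma qPochInf_mul_qPochInf_neg (a : ℂ) (hp : ‖p‖ < 1) :
    qPochInf a p * qPochInf (-a) p = qPochInf (a ^ 2) (p ^ 2) := by
  rw [qPochInf, qPochInf, qPochInf,
    ← (multipliable_one_sub a hp).tprod_mul (multipliable_one_sub (-a) hp)]
  exact tprod_congr fun k => by ring

lemma theta_mul_theta_neg (x : ℂ) (hp : ‖p‖ < 1) :
    theta x p * theta (-x) p = theta (x ^ 2) (p ^ 2) := by
  rw [theta, theta, theta, mul_mul_mul_comm, qPochInf_mul_qPochInf_neg x hp, div_neg,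
    qPochInf_mul_qPochInf_neg _ hp, div_pow]

lemma theta_inv (hp : ‖p‖ < 1) {x : ℂ} (hx : x ≠ 0) : theta x⁻¹ p = -(theta x p / x) := by
  rw [theta, theta, qPochInf_eq_mul _ hp, qPochInf_eq_mul x hp, div_inv_eq_mul, mul_comm p x,
    show x⁻¹ * p = p / x by rw [div_eq_mul_inv, mul_comm]]
  field_simp
  ring

/-- The three-term relation with one argument a fourth root of unity. -/
lemma theta_three_term_I (hp : ‖p‖ < 1) (hp0 : p ≠ 0) {x y u : ℂ} (hx : x ≠ 0) (hy : y ≠ 0)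
    (hu : u ≠ 0) :
    y * (theta (x * y) p * theta (x / y) p) * theta (-u ^ 2) (p ^ 2) -
      u * (theta (x * u) p * theta (x / u) p) * theta (-y ^ 2) (p ^ 2) +
      u * theta (-x ^ 2) (p ^ 2) * (theta (y * u) p * theta (y / u) p) = 0 := by
  have h := theta_three_term hp hp0 hx hy hu Complex.I_ne_zero
  have key : ∀ z : ℂ, theta (z * Complex.I) p * theta (z / Complex.I) p =
      theta (-z ^ 2) (p ^ 2) := fun z => by
    rw [Complex.div_I, theta_mul_theta_neg _ hp, mul_pow, Complex.I_sq, mul_neg_one]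
  rwa [key, key, key] at h

lemma exists_cube_root : ∃ w : ℂ, w ^ 2 + w + 1 = 0 ∧ w ≠ 1 := by
  refine ⟨(-1 + Real.sqrt 3 * Complex.I) / 2, ?_, fun h => ?_⟩
  · have h3 : ((Real.sqrt 3 : ℝ) : ℂ) ^ 2 = 3 := by
      norm_cast; simp
    linear_combination (1 / 4 : ℂ) * Complex.I ^ 2 * h3 + (3 / 4 : ℂ) * Complex.I_sq
  · have := congrArg Complex.re h
    norm_num at this

lemma qPochInf_cube {w : ℂ} (hw : w ^ 2 + w + 1 = 0) (a : ℂ) (hp : ‖p‖ < 1) :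
    qPochInf a p * qPochInf (a * w) p * qPochInf (a * w ^ 2) p = qPochInf (a ^ 3) (p ^ 3) := by
  have h1 := multipliable_one_sub a hp
  have h2 := multipliable_one_sub (a * w) hp
  rw [qPochInf, qPochInf, qPochInf, qPochInf, ← h1.tprod_mul h2,
    ← (h1.mul h2).tprod_mul (multipliable_one_sub (a * w ^ 2) hp)]
  refine tprod_congr fun k => ?_
  have hw3 : w ^ 3 = 1 := by linear_combination (w - 1) * hw
  rw [pow_right_comm]
  linear_combination (-(a * p ^ k) + (a * p ^ k) ^ 2 * w) * hw - (a * p ^ k) ^ 3 * hw3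

/-- The cubic theta relation. -/
theorem theta_cubic (hp : ‖p‖ < 1) (hp0 : p ≠ 0) {x u : ℂ} (hx : x ≠ 0) (hu : u ≠ 0) :
    theta x p ^ 3 * theta (u ^ 3) (p ^ 3) - theta u p ^ 3 * theta (x ^ 3) (p ^ 3) =
      3 * u * (qPochInf (p ^ 3) (p ^ 3) / qPochInf p p) ^ 2 *
        (theta (x * u) p * theta (x / u) p) * (theta x p * theta u p) := by
  obtain ⟨w, hw, hw1⟩ := exists_cube_root
  have hw3 : w ^ 3 = 1 := by linear_combination (w - 1) * hw
  have hw0 : w ≠ 0 := by rintro rfl; norm_num at hw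
  have hwi : w⁻¹ = w ^ 2 := by field_simp; exact hw3.symm
  have hP := qPochInf_self_ne_zero hp
  -- The four parameters are x, u, w, 1. Multiplying by θ(x)θ(u) completes θ(z)θ(zw)θ(z/w) =
  -- θ(z³;p³) for z = x and z = u.
  have h := theta_three_term hp hp0 hx hu hw0 one_ne_zero
  have key : ∀ {z : ℂ}, z ≠ 0 →
      theta z p * (theta (z * w) p * theta (z / w) p) = theta (z ^ 3) (p ^ 3) := fun {z} hz => by
    have e1 := qPochInf_cube hw z hp
    have e2 := qPochInf_cube hw (p / z) hp
    rw [theta, theta, theta, theta, ← div_pow, ← e1, ← e2, div_eq_mul_inv z w, hwi,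
      show p / (z * w) = p / z * w ^ 2 by rw [← hwi]; field_simp,
      show p / (z * w ^ 2) = p / z * w by rw [← hwi]; field_simp]
    ring
  -- The factor 3 of the cubic relation is (1-w)(1-w²); the sign and the w come from θ(1/w) =
  -- -θ(w)/w.
  have hww : theta w p * theta w p = -3 * w * (qPochInf (p ^ 3) (p ^ 3) / qPochInf p p) ^ 2 := by
    have e1 := theta_inv hp hw0
    have e2 := qPochInf_cube hw p hp
    have e3 : theta w p * theta w⁻¹ p =
        (1 - w) * (1 - w ^ 2) * (qPochInf (p * w) p * qPochInf (p * w ^ 2) p) ^ 2 := by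
      rw [theta, theta, div_inv_eq_mul, div_eq_mul_inv, hwi, qPochInf_eq_mul w hp,
        qPochInf_eq_mul (w ^ 2) hp, mul_comm w p, mul_comm (w ^ 2) p]
      ring
    have e4 : (1 - w) * (1 - w ^ 2) = 3 := by linear_combination hw3 - hw
    have e5 : qPochInf (p * w) p * qPochInf (p * w ^ 2) p =
        qPochInf (p ^ 3) (p ^ 3) / qPochInf p p := by
      rw [← e2]; field_simp
    rw [e4, e5, e1] at e3
    field_simp at e3 ⊢
    linear_combination -e3
  simp only [mul_one, div_one] at h
  have kx := key hx
  have ku := key hu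
  refine mul_left_cancel₀ hw0 ?_
  linear_combination (theta x p * theta u p) * h -
    u * (theta (x * u) p * theta (x / u) p) * (theta x p * theta u p) * hww +
    w * theta u p ^ 3 * kx - w * theta x p ^ 3 * ku

end Weierstrass

/-! ### Infinite products encoded as lists, compared by residues -/

section ProductLists

variable {q : ℂ}

/-- A list of triples `(N, a, c)` encodes the product of the `(q^a;q^N)_∞ ^ c`. -/
abbrev ProdList := List (ℕ × ℕ × ℤ)

/-- The value of an encoded product. -/
def prodVal (q : ℂ) (l : ProdList) : ℂ :=
  (l.map fun i => qPochInf (q ^ i.2.1) (q ^ i.1) ^ i.2.2).prod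

/-- The exponent of `1 - q^n` in an encoded product. -/
def expoAt (n : ℕ) (l : ProdList) : ℤ :=
  (l.map fun i => if n % i.1 = i.2.1 % i.1 then i.2.2 else 0).sum

/-- All moduli divide `M` and all residues are standard. -/
def isAdmissible (M : ℕ) (l : ProdList) : Bool :=
  l.all fun i => M % i.1 == 0 && Nat.ble 1 i.2.1 && Nat.ble i.2.1 i.1

/-- Two encoded products have the same exponents, by comparison modulo `M`. -/
def sameProd (M : ℕ) (l l' : ProdList) : Bool :=
  Nat.ble 1 M && isAdmissible M l && isAdmissible M l' &&
    (List.range M).all fun r => expoAt (r + 1) l == expoAt (r + 1) l'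

/-- The encoding of the reciprocal. -/
def recip (l : ProdList) : ProdList := l.map fun i => (i.1, i.2.1, -i.2.2)

lemma prodVal_nil (q : ℂ) : prodVal q [] = 1 := rfl

lemma prodVal_cons (q : ℂ) (i : ℕ × ℕ × ℤ) (l : ProdList) :
    prodVal q (i :: l) = qPochInf (q ^ i.2.1) (q ^ i.1) ^ i.2.2 * prodVal q l := by
  simp [prodVal]

lemma prodVal_append (q : ℂ) (l l' : ProdList) :
    prodVal q (l ++ l') = prodVal q l * prodVal q l' := by simp [prodVal]

lemma prodVal_recip (q : ℂ) (l : ProdList) : prodVal q (recip l) = (prodVal q l)⁻¹ := by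
  induction l with
  | nil => simp [recip, prodVal]
  | cons i l ih =>
    rw [recip, List.map_cons, prodVal_cons, prodVal_cons, mul_inv, ← ih, zpow_neg]
    rfl

lemma prodVal_pow (q : ℂ) (k : ℕ) (l : ProdList) :
    prodVal (q ^ k) l = prodVal q (l.map fun i => (k * i.1, k * i.2.1, i.2.2)) := by
  simp only [prodVal, List.map_map]
  congr 1
  refine List.map_congr_left fun i _ => ?_
  simp [pow_mul]

lemma qPochInf_pow_ne_zero (hq : ‖q‖ < 1) {a N : ℕ} (ha : a ≠ 0) (hN : N ≠ 0) :
    qPochInf (q ^ a) (q ^ N) ≠ 0 := by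
  refine qPochInf_ne_zero (norm_pow_lt_one hq hN) fun k => ?_
  obtain ⟨b, rfl⟩ := Nat.exists_eq_succ_of_ne_zero ha
  rw [← pow_mul, ← pow_add, show b.succ + N * k = b + N * k + 1 by omega]
  exact pow_succ_ne_one hq _

lemma prodVal_ne_zero (hq : ‖q‖ < 1) {M : ℕ} {l : ProdList}
    (hl : isAdmissible M l = true) : prodVal q l ≠ 0 := by
  rw [prodVal]
  refine List.prod_ne_zero fun h => ?_
  obtain ⟨i, hi, h0⟩ := List.mem_map.1 h
  have := List.all_eq_true.1 hl i hi
  simp only [Bool.and_eq_true, beq_iff_eq, Nat.ble_eq] at this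
  obtain ⟨⟨h1, h2⟩, h3⟩ := this
  refine zpow_ne_zero _ (qPochInf_pow_ne_zero hq (by omega) ?_) h0
  omega

lemma qPochInf_eq_prod (a : ℂ) {p : ℂ} (hp : ‖p‖ < 1) {m : ℕ} (hm : m ≠ 0) :
    qPochInf a p = ∏ j ∈ Finset.range m, qPochInf (a * p ^ j) (p ^ m) := by
  have hfin : ∀ n, qPoch a p (m * n) = ∏ j ∈ Finset.range m, qPoch (a * p ^ j) (p ^ m) n := by
    intro n
    induction n with
    | zero => simp [qPoch_zero]
    | succ n ih =>
      rw [Nat.mul_succ, qPoch_add, ih]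
      simp only [qPoch_succ, Finset.prod_mul_distrib]
      congr 1
      exact Finset.prod_congr rfl fun j _ => by ring
  have h1 := (tendsto_qPoch a hp).comp (tendsto_id.const_mul_atTop' (Nat.pos_of_ne_zero hm))
  have h2 := tendsto_finsetProd (Finset.range m)
    fun j _ => tendsto_qPoch (a * p ^ j) (norm_pow_lt_one hp hm)
  exact tendsto_nhds_unique h1 (h2.congr fun n => (hfin n).symm)

/-- For 1 ≤ a ≤ N the positive integers congruent to a are exactly a + Nj with j ≥ 0. Running over
1, …, M instead of 0, …, M-1 accommodates a = N. -/
lemma prod_residues {M N a : ℕ} (f : ℕ → ℂ) (c : ℤ) (hNM : N ∣ M) (ha : 0 < a) (haN : a ≤ N) :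
    ∏ r ∈ Finset.range M, f (r + 1) ^ (if (r + 1) % N = a % N then c else 0) =
      ∏ j ∈ Finset.range (M / N), f (a + N * j) ^ c := by
  obtain ⟨m, rfl⟩ := hNM
  have hN : 0 < N := by omega
  rw [Nat.mul_div_cancel_left m hN]
  have : ∀ r, f (r + 1) ^ (if (r + 1) % N = a % N then c else 0) =
      if (r + 1) % N = a % N then f (r + 1) ^ c else 1 := fun r => by split_ifs <;> simp
  simp only [this]
  rw [← Finset.prod_filter]
  refine (Finset.prod_bij (fun j _ => a - 1 + N * j) ?_ ?_ ?_ ?_).symm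
  · intro j hj
    have hj := Finset.mem_range.1 hj
    have : N * (j + 1) ≤ N * m := Nat.mul_le_mul_left N hj
    rw [mul_add] at this
    refine Finset.mem_filter.2 ⟨Finset.mem_range.2 (by omega), ?_⟩
    rw [show a - 1 + N * j + 1 = a + N * j by omega, Nat.add_mul_mod_self_left]
  · intro i _ j _ h
    exact Nat.eq_of_mul_eq_mul_left hN (by omega)
  · intro r hr
    obtain ⟨hr1, hr2⟩ := Finset.mem_filter.1 hr
    have hr1 := Finset.mem_range.1 hr1
    have hle : a ≤ r + 1 := by
      by_contra! h
      rw [Nat.mod_eq_of_lt (by omega)] at hr2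
      rcases haN.eq_or_lt with rfl | h'
      · simp at hr2
      · rw [Nat.mod_eq_of_lt h'] at hr2; omega
    obtain ⟨j, hj⟩ := (Nat.modEq_iff_dvd' hle).1 (show a ≡ r + 1 [MOD N] from hr2.symm)
    refine ⟨j, Finset.mem_range.2 ?_, by omega⟩
    by_contra! h
    have := Nat.mul_le_mul_left N h
    omega
  · intro j _
    rw [show a - 1 + N * j + 1 = a + N * j by omega]

lemma prodVal_eq_prod (hq : ‖q‖ < 1) {M : ℕ} (hM : M ≠ 0) {l : ProdList}
    (hl : isAdmissible M l = true) :
    prodVal q l = ∏ r ∈ Finset.range M, qPochInf (q ^ (r + 1)) (q ^ M) ^ expoAt (r + 1) l := by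
  induction l with
  | nil => simp [prodVal, expoAt]
  | cons i l ih =>
    rw [isAdmissible, List.all_cons] at hl
    simp only [Bool.and_eq_true, beq_iff_eq, Nat.ble_eq] at hl
    obtain ⟨⟨⟨h1, h2⟩, h3⟩, h4⟩ := hl
    obtain ⟨N, a, c⟩ := i
    simp only at h1 h2 h3
    have hNM : N ∣ M := Nat.dvd_of_mod_eq_zero h1
    have e : ∀ r, expoAt (r + 1) ((N, a, c) :: l) =
        (if (r + 1) % N = a % N then c else 0) + expoAt (r + 1) l := fun r => by simp [expoAt]
    rw [prodVal_cons, ih h4]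
    simp only [e, zpow_add₀ (qPochInf_pow_ne_zero hq (Nat.succ_ne_zero _) hM),
      Finset.prod_mul_distrib]
    congr 1
    rw [prod_residues (fun n => qPochInf (q ^ n) (q ^ M)) c hNM h2 h3, Finset.prod_zpow]
    congr 1
    obtain ⟨m, rfl⟩ := hNM
    have hN : 0 < N := by omega
    rw [Nat.mul_div_cancel_left m hN, qPochInf_eq_prod _ (norm_pow_lt_one hq hN.ne')
      (Nat.ne_zero_of_mul_ne_zero_right hM)]
    refine Finset.prod_congr rfl fun j _ => ?_
    rw [pow_add, pow_mul, pow_mul]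

/-- Products with the same exponents are equal. -/
theorem prodVal_congr (hq : ‖q‖ < 1) (M : ℕ) {l l' : ProdList} (h : sameProd M l l' = true) :
    prodVal q l = prodVal q l' := by
  simp only [sameProd, Bool.and_eq_true, Nat.ble_eq, List.all_eq_true, List.mem_range,
    beq_iff_eq] at h
  obtain ⟨⟨⟨h1, h2⟩, h3⟩, h4⟩ := h
  have hM : M ≠ 0 := by omega
  rw [prodVal_eq_prod hq hM h2, prodVal_eq_prod hq hM h3]
  exact Finset.prod_congr rfl fun r hr => by rw [h4 r (Finset.mem_range.1 hr)]

/-- The encoding of `G(q^k)`. -/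
def listG (k : ℕ) : ProdList := [(k * 5, k * 1, -1), (k * 5, k * 4, -1)]

/-- The encoding of `H(q^k)`. -/
def listH (k : ℕ) : ProdList := [(k * 5, k * 2, -1), (k * 5, k * 3, -1)]

/-- The Bailey argument yields (q²,q³,q⁵;q⁵)_∞/(q;q)_∞; sorting (q;q)_∞ by residues modulo 5 cancels
three of its five classes. -/
lemma G_eq_prodVal (hq : ‖q‖ < 1) (hq0 : q ≠ 0) :
    G q = prodVal q [(5, 1, -1), (5, 4, -1)] := by
  have h := rogersRamanujan_aux hq hq0 zero_le_one
  have hG : G q = ∑' n : ℕ, q ^ (n ^ 2 + 0 * n) / qPoch q q n := by simp [G]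
  have h1 := prodVal_congr hq 5 (l := [(1, 1, 1), (5, 1, -1), (5, 4, -1)])
    (l' := [(5, 5, 1), (5, 2, 1), (5, 3, 1)]) (by decide +kernel)
  have hP := qPochInf_self_ne_zero hq
  rw [← hG, theta, show q ^ 5 / q ^ (2 + 2 * 0) = q ^ 3 by field_simp] at h
  refine mul_left_cancel₀ hP (h.trans ?_)
  simp only [prodVal_cons, prodVal_nil, zpow_one, pow_one, mul_one] at h1 ⊢
  exact h1.symm

lemma H_eq_prodVal (hq : ‖q‖ < 1) (hq0 : q ≠ 0) :
    H q = prodVal q [(5, 2, -1), (5, 3, -1)] := by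
  have h := rogersRamanujan_aux hq hq0 le_rfl
  have hH : H q = ∑' n : ℕ, q ^ (n ^ 2 + 1 * n) / qPoch q q n :=
    tsum_congr fun n => by congr 2; ring
  have h1 := prodVal_congr hq 5 (l := [(1, 1, 1), (5, 2, -1), (5, 3, -1)])
    (l' := [(5, 5, 1), (5, 4, 1), (5, 1, 1)]) (by decide +kernel)
  have hP := qPochInf_self_ne_zero hq
  rw [← hH, theta, show q ^ 5 / q ^ (2 + 2 * 1) = q ^ 1 by field_simp] at h
  refine mul_left_cancel₀ hP (h.trans ?_)
  simp only [prodVal_cons, prodVal_nil, zpow_one, pow_one, mul_one] at h1 ⊢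
  exact h1.symm

lemma G_pow (hq : ‖q‖ < 1) (hq0 : q ≠ 0) {k : ℕ} (hk : k ≠ 0) :
    G (q ^ k) = prodVal q (listG k) := by
  rw [G_eq_prodVal (norm_pow_lt_one hq hk) (pow_ne_zero k hq0), prodVal_pow]
  rfl

lemma H_pow (hq : ‖q‖ < 1) (hq0 : q ≠ 0) {k : ℕ} (hk : k ≠ 0) :
    H (q ^ k) = prodVal q (listH k) := by
  rw [H_eq_prodVal (norm_pow_lt_one hq hk) (pow_ne_zero k hq0), prodVal_pow]
  rfl

/-- The encoding of `χ(q^k)`. -/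
def listChi (k : ℕ) : ProdList := [(k * 4, k * 2, 1), (k * 2, k * 1, -1)]

/-- The encoding of `χ(-q^k)`. -/
def listChiNeg (k : ℕ) : ProdList := [(k * 2, k * 1, 1)]

lemma qPochInf_neg_pow (hq : ‖q‖ < 1) {a N : ℕ} (ha : a ≠ 0) (hN : N ≠ 0) :
    qPochInf (-q ^ a) (q ^ N) = prodVal q [(N * 2, a * 2, 1), (N, a, -1)] := by
  have h := qPochInf_mul_qPochInf_neg (q ^ a) (norm_pow_lt_one hq hN)
  have h0 := qPochInf_pow_ne_zero hq ha hN
  simp only [prodVal_cons, prodVal_nil, zpow_one, zpow_neg_one, mul_one]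
  rw [pow_mul, pow_mul, ← h]
  field_simp

lemma chi_pow (hq : ‖q‖ < 1) {k : ℕ} (hk : k ≠ 0) : chi (q ^ k) = prodVal q (listChi k) := by
  have h := qPochInf_neg_pow (norm_pow_lt_one hq hk) one_ne_zero two_ne_zero
  rw [pow_one] at h
  rw [chi, h, prodVal_pow]
  rfl

lemma chi_neg_pow (q : ℂ) (k : ℕ) : chi (-q ^ k) = prodVal q (listChiNeg k) := by
  simp [chi, listChiNeg, prodVal_cons, prodVal_nil, pow_mul]

/-- The sign encoded by a Boolean. -/
def sgn (s : Bool) : ℂ := if s then -1 else 1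

lemma sgn_mul (s t : Bool) : sgn s * sgn t = sgn (s ^^ t) := by
  cases s <;> cases t <;> simp [sgn]

lemma sgn_div (s t : Bool) : sgn s / sgn t = sgn (s ^^ t) := by
  cases s <;> cases t <;> simp [sgn]

lemma sgn_ne_zero (s : Bool) : sgn s ≠ 0 := by cases s <;> simp [sgn]

lemma sgn_sq (s : Bool) : sgn s ^ 2 = 1 := by cases s <;> simp [sgn]

/-- The encoding of `θ(±q^a;q^N)`. -/
def listTheta (s : Bool) (N a : ℕ) : ProdList :=
  if s then [(N * 2, a * 2, 1), (N, a, -1), (N * 2, (N - a) * 2, 1), (N, N - a, -1)]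
  else [(N, a, 1), (N, N - a, 1)]

lemma theta_sgn_pow (hq : ‖q‖ < 1) (hq0 : q ≠ 0) (s : Bool) {N a : ℕ} (ha : a ≠ 0) (haN : a < N) :
    theta (sgn s * q ^ a) (q ^ N) = prodVal q (listTheta s N a) := by
  have e : q ^ N / q ^ a = q ^ (N - a) := by
    rw [div_eq_iff (pow_ne_zero a hq0), ← pow_add]; congr 1; omega
  cases s
  · simp [theta, sgn, listTheta, prodVal_cons, prodVal_nil, e]
  · simp only [theta, sgn, listTheta, if_true, neg_one_mul, div_neg, e]
    rw [qPochInf_neg_pow hq ha (by omega), qPochInf_neg_pow hq (by omega) (by omega),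
      ← prodVal_append]
    rfl

/-- The left-hand terms of the cubic relation, for `x = ±q^a`, `u = ±q^b`. -/
def cubicLeft (s t : Bool) (N a b : ℕ) : ProdList :=
  listTheta s N a ++ (listTheta s N a ++ (listTheta s N a ++ listTheta t (N * 3) (b * 3)))

/-- The product on the right of the cubic relation. -/
def cubicRight (s t : Bool) (N a b : ℕ) : ProdList :=
  [(N * 3, N * 3, 2), (N, N, -2)] ++ ((listTheta (s ^^ t) N (a + b) ++
    listTheta (s ^^ t) N (a - b)) ++ (listTheta s N a ++ listTheta t N b))

lemma prodVal_cubic (hq : ‖q‖ < 1) (hq0 : q ≠ 0) (s t : Bool) {N a b : ℕ} (hb : 0 < b)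
    (hab : b < a) (haN : a + b < N) :
    prodVal q (cubicLeft s t N a b) - prodVal q (cubicLeft t s N b a) =
      3 * (sgn t * q ^ b) * prodVal q (cubicRight s t N a b) := by
  have hN : N ≠ 0 := by omega
  have h := theta_cubic (norm_pow_lt_one hq hN) (pow_ne_zero N hq0)
    (mul_ne_zero (sgn_ne_zero s) (pow_ne_zero a hq0))
    (mul_ne_zero (sgn_ne_zero t) (pow_ne_zero b hq0))
  have e1 : ∀ (s : Bool) (a : ℕ), (sgn s * q ^ a) ^ 3 = sgn s * q ^ (a * 3) := fun s a => by
    rw [mul_pow, ← pow_mul, pow_succ, sgn_sq, one_mul]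
  have e2 : sgn s * q ^ a * (sgn t * q ^ b) = sgn (s ^^ t) * q ^ (a + b) := by
    rw [← sgn_mul]; ring
  have e3 : sgn s * q ^ a / (sgn t * q ^ b) = sgn (s ^^ t) * q ^ (a - b) := by
    rw [← sgn_div, pow_sub₀ q hq0 hab.le]; field_simp [sgn_ne_zero]
  rw [e1, e1, e2, e3, ← pow_mul, theta_sgn_pow hq hq0 s (by omega) (by omega),
    theta_sgn_pow hq hq0 t (by omega) (by omega), theta_sgn_pow hq hq0 s (by omega) (by omega),
    theta_sgn_pow hq hq0 t (by omega) (by omega), theta_sgn_pow hq hq0 _ (by omega) (by omega),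
    theta_sgn_pow hq hq0 _ (by omega) (by omega)] at h
  have e4 : (qPochInf (q ^ (N * 3)) (q ^ (N * 3)) / qPochInf (q ^ N) (q ^ N)) ^ 2 =
      prodVal q [(N * 3, N * 3, 2), (N, N, -2)] := by
    simp only [prodVal_cons, prodVal_nil, mul_one, zpow_neg, div_eq_mul_inv, mul_pow, inv_pow]
    rfl
  rw [e4] at h
  simp only [cubicLeft, cubicRight, prodVal_append]
  linear_combination h

/-- The three terms of the relation with arguments `x = ±q^(k/2+d)`, `y = ±q^(k/2+c)`,
`u = ±q^(k/2)`. -/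
def quarticList (s : Bool) (N a b c : ℕ) : ProdList :=
  (listTheta s N a ++ listTheta s N b) ++ listTheta true (N * 2) c

lemma prodVal_quartic (hq : ‖q‖ < 1) (hq0 : q ≠ 0) (s t : Bool) {N k c d : ℕ} (hk : 0 < k)
    (hc : 0 < c) (hcd : c < d) (hN : k + d + c < N) (hN' : k + 2 * d < N * 2) :
    prodVal q (quarticList (s ^^ t) N (k + d) d (k + 2 * c)) =
      prodVal q (quarticList t N (k + c) c (k + 2 * d)) +
      sgn t * q ^ c * prodVal q (quarticList s N (k + d + c) (d - c) k) := by
  -- The parameters x, y, u are half-integral powers of q when k is odd, but only their products,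
  -- quotients and squares enter the relation, apart from a common factor r^k.
  obtain ⟨r, hr⟩ := IsAlgClosed.exists_pow_nat_eq q two_pos
  have hr0 : r ≠ 0 := by rintro rfl; exact hq0 (by simpa using hr.symm)
  have hN0 : N ≠ 0 := by omega
  have hrk := pow_ne_zero k hr0
  have hu := mul_ne_zero (sgn_ne_zero false) hrk
  have hy := mul_ne_zero (sgn_ne_zero t) (mul_ne_zero hrk (pow_ne_zero c hq0))
  have hx := mul_ne_zero (sgn_ne_zero (s ^^ t)) (mul_ne_zero hrk (pow_ne_zero d hq0))
  have h := theta_three_term_I (norm_pow_lt_one hq hN0) (pow_ne_zero N hq0) hx hy hu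
  have hr2 : r ^ k * r ^ k = q ^ k := by rw [← hr, ← mul_pow, ← sq]
  have mulf : ∀ (s t : Bool) (a b : ℕ), sgn s * (r ^ k * q ^ a) * (sgn t * (r ^ k * q ^ b)) =
      sgn (s ^^ t) * q ^ (k + a + b) := fun s t a b => by
    rw [← sgn_mul, pow_add, pow_add, ← hr2]; ring
  have divf : ∀ (s t : Bool) {a b : ℕ}, b ≤ a →
      sgn s * (r ^ k * q ^ a) / (sgn t * (r ^ k * q ^ b)) = sgn (s ^^ t) * q ^ (a - b) :=
    fun s t a b hab => by
      rw [← sgn_div, pow_sub₀ q hq0 hab]; field_simp [sgn_ne_zero]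
  have sqf : ∀ (s : Bool) (a : ℕ), -(sgn s * (r ^ k * q ^ a)) ^ 2 =
      sgn true * q ^ (k + 2 * a) := fun s a => by
    rw [mul_pow, sgn_sq, mul_pow, sq (r ^ k), hr2, ← pow_mul, pow_add, mul_comm a 2]; simp [sgn]
  have e0 : r ^ k = r ^ k * q ^ 0 := by simp
  rw [show sgn false * r ^ k = sgn false * (r ^ k * q ^ 0) by rw [← e0], mulf, mulf, mulf,
    divf _ _ hcd.le, divf _ _ (Nat.zero_le _), divf _ _ (Nat.zero_le _), sqf, sqf, sqf,
    ← pow_mul] at h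
  rw [show ((s ^^ t) ^^ t) = s by cases s <;> cases t <;> rfl] at h
  simp only [Bool.xor_false, Nat.sub_zero, add_zero, mul_zero] at h
  rw [theta_sgn_pow hq hq0 s (by omega) (by omega), theta_sgn_pow hq hq0 s (by omega) (by omega),
    theta_sgn_pow hq hq0 true (by omega) (by omega),
    theta_sgn_pow hq hq0 (s ^^ t) (by omega) (by omega),
    theta_sgn_pow hq hq0 (s ^^ t) (by omega) (by omega),
    theta_sgn_pow hq hq0 true (by omega) (by omega),
    theta_sgn_pow hq hq0 true (by omega) (by omega),
    theta_sgn_pow hq hq0 t (by omega) (by omega),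
    theta_sgn_pow hq hq0 t (by omega) (by omega)] at h
  simp only [quarticList, prodVal_append]
  refine mul_left_cancel₀ hrk ?_
  simp only [sgn, Bool.false_eq_true, if_false, pow_zero, mul_one, one_mul] at h ⊢
  linear_combination -h

end ProductLists

/-! ### Convergence of the continued fraction to H/G -/

section ContinuedFraction

variable {q : ℂ}

/-- The series `∑ q^{n²+kn}/(q;q)_n` interpolating `G` and `H`. -/
def rrSeries (q : ℂ) (k : ℕ) : ℂ := ∑' n : ℕ, q ^ (n ^ 2 + k * n) / qPoch q q n

lemma rrSeries_zero (q : ℂ) : rrSeries q 0 = G q := by simp [rrSeries, G]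

lemma rrSeries_one (q : ℂ) : rrSeries q 1 = H q :=
  tsum_congr fun n => by congr 2; ring

lemma exists_norm_rrSeries_term_le (hq : ‖q‖ < 1) :
    ∃ C, ∀ k n : ℕ, ‖q ^ (n ^ 2 + k * n) / qPoch q q n‖ ≤ ‖q‖ ^ n * C := by
  obtain ⟨C, hC0, hC⟩ := exists_norm_invPoch_le hq
  refine ⟨C, fun k n => ?_⟩
  have h := hC n
  rw [invPoch_natCast] at h
  rw [div_eq_mul_inv, norm_mul, norm_pow]
  have : n ≤ n ^ 2 + k * n := (Nat.le_self_pow two_ne_zero n).trans (Nat.le_add_right _ _)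
  exact mul_le_mul (pow_le_pow_of_le_one (norm_nonneg _) hq.le this) h (norm_nonneg _)
    (pow_nonneg (norm_nonneg _) _)

lemma summable_rrSeries (hq : ‖q‖ < 1) (k : ℕ) :
    Summable fun n : ℕ => q ^ (n ^ 2 + k * n) / qPoch q q n := by
  obtain ⟨C, hC⟩ := exists_norm_rrSeries_term_le hq
  exact Summable.of_norm_bounded
    ((summable_geometric_of_lt_one (norm_nonneg _) hq).mul_right C) (hC k)

/-- In the difference of the first two series the n-th term gains 1 - q^n, which cancels the last
factor of (q;q)_n; then n shifts by one. -/
lemma rrSeries_rec (hq : ‖q‖ < 1) (k : ℕ) :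
    rrSeries q k = rrSeries q (k + 1) + q ^ (k + 1) * rrSeries q (k + 2) := by
  rw [← sub_eq_iff_eq_add', rrSeries, rrSeries,
    ← (summable_rrSeries hq k).tsum_sub (summable_rrSeries hq (k + 1)),
    ((summable_rrSeries hq k).sub (summable_rrSeries hq (k + 1))).tsum_eq_zero_add, rrSeries,
    ← tsum_mul_left]
  have h0 : q ^ (0 ^ 2 + k * 0) / qPoch q q 0 - q ^ (0 ^ 2 + (k + 1) * 0) / qPoch q q 0 = 0 := by
    simp
  rw [h0, zero_add]
  refine tsum_congr fun n => ?_
  have h1 := qPoch_self_ne_zero hq n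
  have h2 : 1 - q ^ (n + 1) ≠ 0 := sub_ne_zero.2 (pow_succ_ne_one hq n).symm
  rw [qPoch_succ, ← pow_succ']
  field_simp
  ring

lemma tendsto_rrSeries (hq : ‖q‖ < 1) : Tendsto (rrSeries q) atTop (𝓝 1) := by
  obtain ⟨C, hC⟩ := exists_norm_rrSeries_term_le hq
  have h := tendsto_tsum_of_dominated_convergence (𝓕 := atTop)
    (f := fun (k n : ℕ) => q ^ (n ^ 2 + k * n) / qPoch q q n)
    (g := fun n : ℕ => if n = 0 then 1 else 0)
    ((summable_geometric_of_lt_one (norm_nonneg _) hq).mul_right C) (fun n => ?_)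
    (.of_forall hC)
  · rw [tsum_ite_eq] at h
    exact h
  · rcases eq_or_ne n 0 with rfl | hn
    · simp [qPoch_zero]
    · have h1 : Tendsto (fun k : ℕ => q ^ (n ^ 2) * (q ^ n) ^ k / qPoch q q n) atTop
          (𝓝 (q ^ (n ^ 2) * 0 / qPoch q q n)) :=
        ((tendsto_pow_atTop_nhds_zero_of_norm_lt_one (norm_pow_lt_one hq hn)).const_mul _).div_const
          _
      simp only [if_neg hn]
      rw [mul_zero, zero_div] at h1
      refine h1.congr fun k => ?_
      rw [pow_add, mul_comm k n, pow_mul q n k]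

/-- Each step enlarges the maximum of two consecutive norms by at most 1 + |q|^n ≤ exp(|q|^n), and
the exponents are summable. -/
lemma exists_norm_le_of_rec (hq : ‖q‖ < 1) {y : ℕ → ℂ}
    (hy : ∀ n, y (n + 2) = y (n + 1) + q ^ (n + 1) * y n) : ∃ C, ∀ n, ‖y n‖ ≤ C := by
  set D : ℝ := max ‖y 0‖ ‖y 1‖
  have key : ∀ n, max ‖y n‖ ‖y (n + 1)‖ ≤
      D * Real.exp (∑ k ∈ Finset.range n, ‖q‖ ^ k) := by
    intro n
    induction n with
    | zero => simp [D]
    | succ n ih =>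
      set E := D * Real.exp (∑ k ∈ Finset.range n, ‖q‖ ^ k)
      have hn1 := (le_max_left _ _).trans ih
      have hn2 := (le_max_right _ _).trans ih
      have hE : 0 ≤ E := (norm_nonneg _).trans hn1
      have hqn : 0 ≤ ‖q‖ ^ n := by positivity
      have hle : E * (1 + ‖q‖ ^ n) ≤
          D * Real.exp (∑ k ∈ Finset.range (n + 1), ‖q‖ ^ k) := by
        rw [Finset.sum_range_succ, Real.exp_add, ← mul_assoc]
        refine mul_le_mul_of_nonneg_left ?_ hE
        linarith [Real.add_one_le_exp (‖q‖ ^ n)]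
      refine le_trans (max_le ?_ ?_) hle
      · nlinarith
      · rw [hy]
        refine (norm_add_le _ _).trans ?_
        rw [norm_mul, norm_pow]
        have : ‖q‖ ^ (n + 1) ≤ ‖q‖ ^ n := pow_le_pow_of_le_one (norm_nonneg _) hq.le n.le_succ
        have := mul_le_mul this hn1 (norm_nonneg _) hqn
        linarith
  refine ⟨D * Real.exp (∑' k, ‖q‖ ^ k), fun n => (le_max_left _ _).trans ((key n).trans ?_)⟩
  have hD : 0 ≤ D := (norm_nonneg _).trans (le_max_left _ _)
  gcongr
  exact (summable_geometric_of_lt_one (norm_nonneg _) hq).sum_le_tsum _ fun _ _ => by positivity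

lemma tendsto_of_rec (hq : ‖q‖ < 1) {y : ℕ → ℂ}
    (hy : ∀ n, y (n + 2) = y (n + 1) + q ^ (n + 1) * y n) :
    Tendsto y atTop (𝓝 (y 1 * rrSeries q 1 + q * y 0 * rrSeries q 2)) := by
  obtain ⟨C, hC⟩ := exists_norm_le_of_rec hq hy
  -- A conserved quantity, as `rrSeries` solves the adjoint recurrence. Since `rrSeries` tends to 1
  -- and q^(n+1) y_n to 0, its constant value is the limit of y.
  have hinv : ∀ n, y (n + 1) * rrSeries q (n + 1) + q ^ (n + 1) * y n * rrSeries q (n + 2) =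
      y 1 * rrSeries q 1 + q * y 0 * rrSeries q 2 := by
    intro n
    induction n with
    | zero => simp
    | succ n ih =>
      rw [← ih, rrSeries_rec hq (n + 1), hy]
      ring
  have h1 : Tendsto (fun n => rrSeries q (n + 1)) atTop (𝓝 1) :=
    (tendsto_rrSeries hq).comp (tendsto_add_atTop_nat 1)
  have h2 : Tendsto (fun n => rrSeries q (n + 2)) atTop (𝓝 1) :=
    (tendsto_rrSeries hq).comp (tendsto_add_atTop_nat 2)
  have h3 : Tendsto (fun n => q ^ (n + 1) * y n) atTop (𝓝 0) := by
    have hq0 : Tendsto (fun n : ℕ => q ^ (n + 1)) atTop (𝓝 0) :=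
      (tendsto_pow_atTop_nhds_zero_of_norm_lt_one hq).comp (tendsto_add_atTop_nat 1)
    exact hq0.zero_mul_isBoundedUnder_le
      (isBoundedUnder_of ⟨C, fun n => hC n⟩)
  have h4 := ((tendsto_const_nhds (x := y 1 * rrSeries q 1 + q * y 0 * rrSeries q 2)).sub
    (h3.mul h2)).div h1 one_ne_zero
  rw [zero_mul, sub_zero, div_one] at h4
  refine (tendsto_add_atTop_iff_nat 1).1 (h4.congr' ?_)
  filter_upwards [h1.eventually_ne one_ne_zero] with n hn
  rw [Pi.div_apply, ← hinv n, div_eq_iff hn]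
  ring

/-- With initial values (0, 1) and (1, 1), numerators and denominators tend to `rrSeries q 1` = H(q)
and to `rrSeries q 1 + q * rrSeries q 2`, which is `rrSeries q 0` = G(q). -/
lemma tendsto_contFrac (hq : ‖q‖ < 1) (hG : G q ≠ 0) :
    Tendsto (contFrac q).convs atTop (𝓝 (H q / G q)) := by
  have hs : ∀ n, (contFrac q).s.get? n = some ⟨q ^ n, 1⟩ := fun n => rfl
  have hA : ∀ n, (contFrac q).nums (n + 2) =
      (contFrac q).nums (n + 1) + q ^ (n + 1) * (contFrac q).nums n := fun n => by
    rw [GenContFract.nums_recurrence (hs (n + 1)) rfl rfl, one_mul]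
  have hB : ∀ n, (contFrac q).dens (n + 2) =
      (contFrac q).dens (n + 1) + q ^ (n + 1) * (contFrac q).dens n := fun n => by
    rw [GenContFract.dens_recurrence (hs (n + 1)) rfl rfl, one_mul]
  have hA0 : (contFrac q).nums 0 = 0 := GenContFract.zeroth_num_eq_h
  have hA1 : (contFrac q).nums 1 = 1 := by
    rw [GenContFract.first_num_eq (hs 0)]; simp [contFrac]
  have hB0 : (contFrac q).dens 0 = 1 := GenContFract.zeroth_den_eq_one
  have hB1 : (contFrac q).dens 1 = 1 := GenContFract.first_den_eq (hs 0)
  have h1 := tendsto_of_rec hq hA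
  have h2 := tendsto_of_rec hq hB
  rw [hA0, hA1, mul_zero, zero_mul, add_zero, one_mul, rrSeries_one] at h1
  have h3 := rrSeries_rec hq 0
  rw [zero_add, pow_one, rrSeries_zero] at h3
  rw [hB0, hB1, mul_one, one_mul, ← h3] at h2
  exact h1.div h2 hG

lemma contFracValue_eq (hq : ‖q‖ < 1) (hG : G q ≠ 0) : contFracValue q = H q / G q :=
  (tendsto_contFrac hq hG).limUnder_eq

lemma G_zero : G 0 = 1 := by
  rw [G, tsum_eq_single 0 fun n hn => by simp [hn]]
  simp [qPoch_zero]

lemma H_zero : H 0 = 1 := by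
  rw [H, tsum_eq_single 0 fun n hn => by simp [hn]]
  simp [qPoch_zero]

lemma chi_zero : chi 0 = 1 := by simp [chi, qPochInf]

lemma G_ne_zero (hq : ‖q‖ < 1) : G q ≠ 0 := by
  rcases eq_or_ne q 0 with rfl | hq0
  · simp [G_zero]
  · rw [G_eq_prodVal hq hq0]
    exact prodVal_ne_zero (M := 5) hq (by decide +kernel)

lemma H_ne_zero (hq : ‖q‖ < 1) : H q ≠ 0 := by
  rcases eq_or_ne q 0 with rfl | hq0
  · simp [H_zero]
  · rw [H_eq_prodVal hq hq0]
    exact prodVal_ne_zero (M := 5) hq (by decide +kernel)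

lemma R_pow {t : ℂ} (hq : ‖q‖ < 1) (ht : t ^ 5 = q) {k : ℕ} (hk : k ≠ 0) :
    R (t ^ k) = t ^ k * (H (q ^ k) / G (q ^ k)) := by
  rw [R, pow_right_comm, ht,
    contFracValue_eq (norm_pow_lt_one hq hk) (G_ne_zero (norm_pow_lt_one hq hk))]

end ContinuedFraction

/-! ### Transfer of theta relations to proportional products -/

section Combination

variable {q : ℂ}

lemma prodVal_ne_zero_of_append {M : ℕ} (hq : ‖q‖ < 1) {t A l : ProdList}
    (h : sameProd M (t ++ A) l = true) : prodVal q t ≠ 0 := by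
  simp only [sameProd, isAdmissible, List.all_append, Bool.and_eq_true] at h
  exact prodVal_ne_zero (M := M) hq h.1.1.2.1

/-- A three-term relation `t₁ - t₂ = c t₃` carried over to proportional products. -/
lemma prodVal_sub_of_relation {c : ℂ} (hq : ‖q‖ < 1) (M : ℕ) {t₁ t₂ t₃ A B : ProdList}
    (h : prodVal q t₁ - prodVal q t₂ = c * prodVal q t₃)
    (hAB : sameProd M (t₁ ++ B) (t₂ ++ A) = true) :
    prodVal q A - prodVal q B = c * prodVal q (A ++ (t₃ ++ recip t₁)) := by
  have h1 := prodVal_ne_zero_of_append hq hAB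
  have h2 := prodVal_congr hq M hAB
  rw [prodVal_append, prodVal_append] at h2
  rw [prodVal_append, prodVal_append, prodVal_recip]
  field_simp
  linear_combination (prodVal q A) * h - h2

/-- The cubic relation carried over to proportional products. -/
lemma prodVal_cubic_sub (hq : ‖q‖ < 1) (hq0 : q ≠ 0) (M : ℕ) (s t : Bool) {N a b : ℕ}
    {A B : ProdList} (hb : 0 < b) (hab : b < a) (haN : a + b < N)
    (hAB : sameProd M (cubicLeft s t N a b ++ B) (cubicLeft t s N b a ++ A) = true) :
    prodVal q A - prodVal q B = 3 * (sgn t * q ^ b) *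
      prodVal q (A ++ (cubicRight s t N a b ++ recip (cubicLeft s t N a b))) :=
  prodVal_sub_of_relation hq M (prodVal_cubic hq hq0 s t hb hab haN) hAB

end Combination

/-! ### Product forms of S, T, U, V, W, X, Y, Z -/

section Functions

variable {q : ℂ}

/-- The encoding of a cube. -/
def cube (l : ProdList) : ProdList := l ++ (l ++ l)

lemma prodVal_cube (q : ℂ) (l : ProdList) : prodVal q (cube l) = prodVal q l ^ 3 := by
  rw [cube, prodVal_append, prodVal_append]; ring

/-- The encoding of a square. -/
def square (l : ProdList) : ProdList := l ++ l

lemma prodVal_square (q : ℂ) (l : ProdList) : prodVal q (square l) = prodVal q l ^ 2 := by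
  rw [square, prodVal_append, sq]

lemma G_one (hq : ‖q‖ < 1) (hq0 : q ≠ 0) : G q = prodVal q (listG 1) := by
  simpa using G_pow hq hq0 one_ne_zero

lemma H_one (hq : ‖q‖ < 1) (hq0 : q ≠ 0) : H q = prodVal q (listH 1) := by
  simpa using H_pow hq hq0 one_ne_zero

/-- The encoding of `S(q)`. -/
def listS : ProdList :=
  square (listG 1) ++ listH 2 ++ listG 3 ++ square (listH 4) ++ listH 12

/-- The encoding of `T(q)`. -/
def listT : ProdList :=
  square (listH 1) ++ listG 2 ++ listH 3 ++ square (listG 4) ++ listG 12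

/-- The product `U(q)/(3q)`. -/
def listU : ProdList := (cube (listG 1) ++ cube (listH 1) ++ listH 6) ++
  (cubicRight true false 5 2 1 ++ recip (cubicLeft true false 5 2 1))

/-- The product `V(q)/(3q)`. -/
def listV : ProdList := (cube (listG 2) ++ listG 3 ++ listH 3) ++
  (cubicRight false true 5 2 1 ++ recip (cubicLeft false true 5 2 1))

/-- The product `W(q)/(3q³)`. -/
def listW : ProdList := (cube (listH 1) ++ listG 6 ++ listH 6) ++
  (cubicRight false false 10 4 3 ++ recip (cubicLeft false false 10 4 3))

/-- The product `X(q)/(3q)`. -/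
def listX : ProdList := (cube (listG 1) ++ listG 6 ++ listH 6) ++
  (cubicRight false false 10 2 1 ++ recip (cubicLeft false false 10 2 1))

/-- The product `-Y(q)/(3q³)`. -/
def listY : ProdList := (cube (listG 2) ++ listH 3 ++ listG 12) ++
  (cubicRight false true 10 4 3 ++ recip (cubicLeft false true 10 4 3))

/-- The product `-Z(q)/(3q)`. -/
def listZ : ProdList := (cube (listH 2) ++ listG 3 ++ listH 12) ++
  (cubicRight false true 10 2 1 ++ recip (cubicLeft false true 10 2 1))

lemma S_eq (hq : ‖q‖ < 1) (hq0 : q ≠ 0) : S q = prodVal q listS := by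
  simp only [S, listS, prodVal_append, prodVal_square, G_one hq hq0, G_pow hq hq0, H_pow hq hq0,
    ne_eq, OfNat.ofNat_ne_zero,
    not_false_eq_true]

lemma T_eq (hq : ‖q‖ < 1) (hq0 : q ≠ 0) : T q = prodVal q listT := by
  simp only [T, listT, prodVal_append, prodVal_square, H_one hq hq0, G_pow hq hq0, H_pow hq hq0,
    ne_eq, OfNat.ofNat_ne_zero,
    not_false_eq_true]

/-- The cubic relation with p = q⁵, x = -q², u = q. As θ(-q²;q⁵) = H(q)/H(q²) and θ(q;q⁵) = 1/G(q),
its two left terms are in the ratio of the two terms of U. The other five functions are treated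
alike. -/
lemma U_eq (hq : ‖q‖ < 1) (hq0 : q ≠ 0) : U q = 3 * q * prodVal q listU := by
  have e : U q = prodVal q (cube (listG 1) ++ cube (listH 1) ++ listH 6) -
      prodVal q (cube (listH 2) ++ listG 3 ++ listH 3) := by
    simp only [U, prodVal_append, prodVal_cube, G_one hq hq0, H_one hq hq0, G_pow hq hq0,
      H_pow hq hq0, ne_eq, OfNat.ofNat_ne_zero,
    not_false_eq_true]
  have h := prodVal_cubic_sub hq hq0 30 true false (N := 5) (a := 2) (b := 1)
    (A := cube (listG 1) ++ cube (listH 1) ++ listH 6)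
    (B := cube (listH 2) ++ listG 3 ++ listH 3)
    (by norm_num) (by norm_num) (by norm_num) (by decide +kernel)
  rw [e, h, listU]
  simp [sgn]

lemma V_eq (hq : ‖q‖ < 1) (hq0 : q ≠ 0) : V q = 3 * q * prodVal q listV := by
  have e : V q = prodVal q (cube (listG 1) ++ cube (listH 1) ++ listG 6) -
      prodVal q (cube (listG 2) ++ listG 3 ++ listH 3) := by
    simp only [V, prodVal_append, prodVal_cube, G_one hq hq0, H_one hq hq0, G_pow hq hq0,
      H_pow hq hq0, ne_eq, OfNat.ofNat_ne_zero,
    not_false_eq_true]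
  -- Here u = -q makes the coefficient -3q; taking the terms of V in reverse order compensates the
  -- sign.
  have h := prodVal_cubic_sub hq hq0 30 false true (N := 5) (a := 2) (b := 1)
    (A := cube (listG 2) ++ listG 3 ++ listH 3)
    (B := cube (listG 1) ++ cube (listH 1) ++ listG 6)
    (by norm_num) (by norm_num) (by norm_num) (by decide +kernel)
  rw [e, ← neg_sub, h, listV]
  simp [sgn]

/-- In base q¹⁰ the thetas are again quotients: θ(q⁴;q¹⁰) = 1/H(q²) and θ(q³;q¹⁰) = G(q²)/H(q). -/
lemma W_eq (hq : ‖q‖ < 1) (hq0 : q ≠ 0) : W q = 3 * q ^ 3 * prodVal q listW := by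
  have e : W q = prodVal q (cube (listH 1) ++ listG 6 ++ listH 6) -
      prodVal q (cube (listG 2) ++ cube (listH 2) ++ listH 3) := by
    simp only [W, prodVal_append, prodVal_cube, H_one hq hq0, G_pow hq hq0,
      H_pow hq hq0, ne_eq, OfNat.ofNat_ne_zero,
    not_false_eq_true]
  have h := prodVal_cubic_sub hq hq0 30 false false (N := 10) (a := 4) (b := 3)
    (A := cube (listH 1) ++ listG 6 ++ listH 6)
    (B := cube (listG 2) ++ cube (listH 2) ++ listH 3)
    (by norm_num) (by norm_num) (by norm_num) (by decide +kernel)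
  rw [e, h, listW]
  simp [sgn]

lemma X_eq (hq : ‖q‖ < 1) (hq0 : q ≠ 0) : X q = 3 * q * prodVal q listX := by
  have e : X q = prodVal q (cube (listG 1) ++ listG 6 ++ listH 6) -
      prodVal q (cube (listG 2) ++ cube (listH 2) ++ listG 3) := by
    simp only [X, prodVal_append, prodVal_cube, G_one hq hq0, G_pow hq hq0,
      H_pow hq hq0, ne_eq, OfNat.ofNat_ne_zero,
    not_false_eq_true]
  have h := prodVal_cubic_sub hq hq0 30 false false (N := 10) (a := 2) (b := 1)
    (A := cube (listG 1) ++ listG 6 ++ listH 6)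
    (B := cube (listG 2) ++ cube (listH 2) ++ listG 3)
    (by norm_num) (by norm_num) (by norm_num) (by decide +kernel)
  rw [e, h, listX]
  simp [sgn]

lemma Y_eq (hq : ‖q‖ < 1) (hq0 : q ≠ 0) : Y q = -(3 * q ^ 3) * prodVal q listY := by
  have e : Y q = prodVal q (cube (listG 2) ++ listH 3 ++ listG 12) -
      prodVal q (cube (listH 1) ++ cube (listG 4) ++ listG 6) := by
    simp only [Y, prodVal_append, prodVal_cube, H_one hq hq0, G_pow hq hq0,
      H_pow hq hq0, ne_eq, OfNat.ofNat_ne_zero,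
    not_false_eq_true]
  have h := prodVal_cubic_sub hq hq0 60 false true (N := 10) (a := 4) (b := 3)
    (A := cube (listG 2) ++ listH 3 ++ listG 12)
    (B := cube (listH 1) ++ cube (listG 4) ++ listG 6)
    (by norm_num) (by norm_num) (by norm_num) (by decide +kernel)
  rw [e, h, listY]
  simp [sgn]

lemma Z_eq (hq : ‖q‖ < 1) (hq0 : q ≠ 0) : Z q = -(3 * q) * prodVal q listZ := by
  have e : Z q = prodVal q (cube (listH 2) ++ listG 3 ++ listH 12) -
      prodVal q (cube (listG 1) ++ cube (listH 4) ++ listH 6) := by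
    simp only [Z, prodVal_append, prodVal_cube, G_one hq hq0, G_pow hq hq0,
      H_pow hq hq0, ne_eq, OfNat.ofNat_ne_zero,
    not_false_eq_true]
  have h := prodVal_cubic_sub hq hq0 60 false true (N := 10) (a := 2) (b := 1)
    (A := cube (listH 2) ++ listG 3 ++ listH 12)
    (B := cube (listG 1) ++ cube (listH 4) ++ listH 6)
    (by norm_num) (by norm_num) (by norm_num) (by decide +kernel)
  rw [e, h, listZ]
  simp [sgn]

end Functions

/-! ### Three uses of the relation with a fourth root of unity -/

section Quartic

variable {q : ℂ}

/-- `prodVal_quartic` has the form T₁ = T₂ ± q^c T₃. This lemma and the next two differ in which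
pair of terms is proportional to A and B: T₂ and T₃, then T₁ and T₃, then T₁ and T₂. -/
lemma prodVal_quartic_add (hq : ‖q‖ < 1) (hq0 : q ≠ 0) (M : ℕ) (s t : Bool) {N k c d : ℕ}
    {A B : ProdList} (hk : 0 < k) (hc : 0 < c) (hcd : c < d) (hN : k + d + c < N)
    (hN' : k + 2 * d < N * 2)
    (hAB : sameProd M (quarticList t N (k + c) c (k + 2 * d) ++ B)
      (quarticList s N (k + d + c) (d - c) k ++ A) = true) :
    prodVal q A + sgn t * q ^ c * prodVal q B =
      prodVal q (A ++ (quarticList (s ^^ t) N (k + d) d (k + 2 * c) ++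
        recip (quarticList t N (k + c) c (k + 2 * d)))) := by
  have h := prodVal_quartic hq hq0 s t hk hc hcd hN hN'
  have h1 := prodVal_ne_zero_of_append hq hAB
  have h2 := prodVal_congr hq M hAB
  rw [prodVal_append, prodVal_append] at h2
  rw [prodVal_append, prodVal_append, prodVal_recip, h]
  field_simp
  linear_combination (sgn t * q ^ c) * h2

lemma prodVal_quartic_sub (hq : ‖q‖ < 1) (hq0 : q ≠ 0) (M : ℕ) (s t : Bool) {N k c d : ℕ}
    {A B : ProdList} (hk : 0 < k) (hc : 0 < c) (hcd : c < d) (hN : k + d + c < N)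
    (hN' : k + 2 * d < N * 2)
    (hAB : sameProd M (quarticList (s ^^ t) N (k + d) d (k + 2 * c) ++ B)
      (quarticList s N (k + d + c) (d - c) k ++ A) = true) :
    prodVal q A - sgn t * q ^ c * prodVal q B =
      prodVal q (A ++ (quarticList t N (k + c) c (k + 2 * d) ++
        recip (quarticList (s ^^ t) N (k + d) d (k + 2 * c)))) := by
  have h := prodVal_quartic hq hq0 s t hk hc hcd hN hN'
  have h1 := prodVal_ne_zero_of_append hq hAB
  have h2 := prodVal_congr hq M hAB
  rw [prodVal_append, prodVal_append] at h2
  rw [prodVal_append, prodVal_append, prodVal_recip, ← sub_eq_iff_eq_add.2 h]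
  field_simp
  linear_combination -(sgn t * q ^ c) * h2

lemma prodVal_quartic_diff (hq : ‖q‖ < 1) (hq0 : q ≠ 0) (M : ℕ) (s t : Bool) {N k c d : ℕ}
    {A B : ProdList} (hk : 0 < k) (hc : 0 < c) (hcd : c < d) (hN : k + d + c < N)
    (hN' : k + 2 * d < N * 2)
    (hAB : sameProd M (quarticList t N (k + c) c (k + 2 * d) ++ B)
      (quarticList (s ^^ t) N (k + d) d (k + 2 * c) ++ A) = true) :
    prodVal q B - prodVal q A = sgn t * q ^ c *
      prodVal q (A ++ (quarticList s N (k + d + c) (d - c) k ++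
        recip (quarticList t N (k + c) c (k + 2 * d)))) := by
  have h := prodVal_quartic hq hq0 s t hk hc hcd hN hN'
  have h1 := prodVal_ne_zero_of_append hq hAB
  have h2 := prodVal_congr hq M hAB
  rw [prodVal_append, prodVal_append] at h2
  rw [prodVal_append, prodVal_append, prodVal_recip]
  field_simp
  linear_combination h2 + prodVal q A * h

end Quartic

/-! ### Numerators and denominators of the four quotients -/

section Quotients

variable {q : ℂ}

/-- The product in the numerator of the first quotient. -/
def listNum1 : ProdList := (listH 1 ++ square (listH 3) ++ listG 12) ++
  (quarticList false 15 6 3 5 ++ recip (quarticList false 15 4 1 9))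

/-- Base q¹⁵ with u = q^(3/2), y = uq, x = uq³. -/
lemma num1_eq (hq : ‖q‖ < 1) (hq0 : q ≠ 0) :
    H q * H (q ^ 3) ^ 2 * G (q ^ 12) + q * G q * G (q ^ 3) ^ 2 * H (q ^ 12) =
      prodVal q listNum1 := by
  have h : prodVal q (listH 1 ++ square (listH 3) ++ listG 12) + sgn false * q ^ 1 * prodVal q 
        (listG 1 ++ square (listG 3) ++ listH 12) =
      prodVal q listNum1 :=
    prodVal_quartic_add hq hq0 60 false false (k := 3) (d := 3) (by norm_num) (by norm_num)
      (by norm_num) (by norm_num) (by norm_num) (by decide +kernel)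
  simp only [prodVal_append, prodVal_square, sgn, Bool.false_eq_true, if_false] at h
  simp only [G_one hq hq0, H_one hq hq0, 
    G_pow hq hq0, H_pow hq hq0, ne_eq, OfNat.ofNat_ne_zero, not_false_eq_true]
  linear_combination h

/-- The product in the denominator of the first quotient. -/
def listDen1 : ProdList := (listG 1 ++ listG 3 ++ listH 6 ++ listG 12) ++
  (quarticList false 15 9 3 10 ++ recip (quarticList false 15 8 2 12))

lemma den1_eq (hq : ‖q‖ < 1) (hq0 : q ≠ 0) :
    G q * G (q ^ 3) * H (q ^ 6) * G (q ^ 12) + q ^ 2 * H q * H (q ^ 3) * G (q ^ 6) * H (q ^ 12) =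
      prodVal q listDen1 := by
  have h : prodVal q (listG 1 ++ listG 3 ++ listH 6 ++ listG 12) + sgn false * q ^ 2 * prodVal q 
        (listH 1 ++ listH 3 ++ listG 6 ++ listH 12) =
      prodVal q listDen1 :=
    prodVal_quartic_add hq hq0 60 false false (k := 6) (d := 3) (by norm_num) (by norm_num)
      (by norm_num) (by norm_num) (by norm_num) (by decide +kernel)
  simp only [prodVal_append, sgn, Bool.false_eq_true, if_false] at h
  simp only [G_one hq hq0, H_one hq hq0, 
    G_pow hq hq0, H_pow hq hq0, ne_eq, OfNat.ofNat_ne_zero, not_false_eq_true]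
  linear_combination h

/-- The product in the numerator of the second quotient, up to a monomial. -/
def listNum2 : ProdList := (listU ++ listG 2 ++ listH 3 ++ listG 12) ++
  (quarticList false 15 6 3 5 ++ recip (quarticList true 15 4 1 9))

/-- The parameters of the first quotient with y replaced by -y, which turns the plus sign into a
minus. -/
lemma num2_eq (hq : ‖q‖ < 1) (hq0 : q ≠ 0) :
    U q * G (q ^ 2) * H (q ^ 3) * G (q ^ 12) - q * V q * H (q ^ 2) * G (q ^ 3) * H (q ^ 12) =
      3 * q * prodVal q listNum2 := by
  have h : prodVal q (listU ++ listG 2 ++ listH 3 ++ listG 12) + sgn true * q ^ 1 * prodVal q 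
        (listV ++ listH 2 ++ listG 3 ++ listH 12) =
      prodVal q listNum2 :=
    prodVal_quartic_add hq hq0 60 true true (k := 3) (d := 3) (by norm_num) (by norm_num)
      (by norm_num) (by norm_num) (by norm_num) (by decide +kernel)
  simp only [prodVal_append, sgn, if_true] at h
  simp only [U_eq hq hq0, V_eq hq hq0, 
    G_pow hq hq0, H_pow hq hq0, ne_eq, OfNat.ofNat_ne_zero, not_false_eq_true]
  linear_combination (3 * q) * h

/-- The product in the denominator of the second quotient, up to a monomial. -/
def listDen2 : ProdList := (listV ++ listH 2 ++ listH 6 ++ listG 12) ++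
  (quarticList false 15 9 3 10 ++ recip (quarticList true 15 8 2 12))

lemma den2_eq (hq : ‖q‖ < 1) (hq0 : q ≠ 0) :
    V q * H (q ^ 2) * H (q ^ 6) * G (q ^ 12) - q ^ 2 * U q * G (q ^ 2) * G (q ^ 6) * H (q ^ 12) =
      3 * q * prodVal q listDen2 := by
  have h : prodVal q (listV ++ listH 2 ++ listH 6 ++ listG 12) + sgn true * q ^ 2 * prodVal q 
        (listU ++ listG 2 ++ listG 6 ++ listH 12) =
      prodVal q listDen2 :=
    prodVal_quartic_add hq hq0 60 true true (k := 6) (d := 3) (by norm_num) (by norm_num)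
      (by norm_num) (by norm_num) (by norm_num) (by decide +kernel)
  simp only [prodVal_append, sgn, if_true] at h
  simp only [V_eq hq hq0, U_eq hq hq0, 
    G_pow hq hq0, H_pow hq hq0, ne_eq, OfNat.ofNat_ne_zero, not_false_eq_true]
  linear_combination (3 * q) * h

/-- The product in the numerator of the third quotient, up to a monomial. -/
def listNum3 : ProdList := (listW ++ listG 1 ++ listH 12 ++ listG 24) ++
  (quarticList false 30 18 6 10 ++ recip (quarticList false 30 11 1 24))

/-- W carries 3q³ and q²X carries q² · 3q, so the two products enter with equal weight; their
difference contributes one more q. Against the -3q of the denominator this leaves the q³ of the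
theorem. -/
lemma num3_eq (hq : ‖q‖ < 1) (hq0 : q ≠ 0) :
    W q * G q * H (q ^ 12) * G (q ^ 24) - q ^ 2 * X q * H q * G (q ^ 12) * H (q ^ 24) =
      -(3 * q ^ 4) * prodVal q listNum3 := by
  have h : prodVal q (listX ++ listH 1 ++ listG 12 ++ listH 24) -
        prodVal q (listW ++ listG 1 ++ listH 12 ++ listG 24) =
      sgn false * q ^ 1 * prodVal q listNum3 :=
    prodVal_quartic_diff hq hq0 120 false false (k := 10) (d := 7) (by norm_num) (by norm_num)
      (by norm_num) (by norm_num) (by norm_num) (by decide +kernel)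
  simp only [prodVal_append, sgn, Bool.false_eq_true, if_false] at h
  simp only [W_eq hq hq0, X_eq hq hq0, G_one hq hq0, H_one hq hq0, 
    G_pow hq hq0, H_pow hq hq0, ne_eq, OfNat.ofNat_ne_zero, not_false_eq_true]
  linear_combination -(3 * q ^ 3) * h

/-- The product in the denominator of the third quotient, up to a monomial. -/
def listDen3 : ProdList := (listX ++ listH 1 ++ listH 6 ++ listG 24) ++
  (quarticList false 30 12 6 20 ++ recip (quarticList false 30 13 7 18))

lemma den3_eq (hq : ‖q‖ < 1) (hq0 : q ≠ 0) :
    q ^ 4 * W q * G q * G (q ^ 6) * H (q ^ 24) - X q * H q * H (q ^ 6) * G (q ^ 24) =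
      -(3 * q) * prodVal q listDen3 := by
  have h : prodVal q (listX ++ listH 1 ++ listH 6 ++ listG 24) - sgn false * q ^ 6 * prodVal q 
        (listW ++ listG 1 ++ listG 6 ++ listH 24) =
      prodVal q listDen3 :=
    prodVal_quartic_sub hq hq0 120 false false (k := 6) (d := 7) (by norm_num) (by norm_num)
      (by norm_num) (by norm_num) (by norm_num) (by decide +kernel)
  simp only [prodVal_append, sgn, Bool.false_eq_true, if_false] at h
  simp only [X_eq hq hq0, W_eq hq hq0, G_one hq hq0, H_one hq hq0, 
    G_pow hq hq0, H_pow hq hq0, ne_eq, OfNat.ofNat_ne_zero, not_false_eq_true]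
  linear_combination -(3 * q) * h

/-- The product in the numerator of the fourth quotient, up to a monomial. -/
def listNum4 : ProdList := (listS ++ listY ++ listH 12 ++ listG 24) ++
  (quarticList false 30 18 6 10 ++ recip (quarticList true 30 11 1 24))

lemma num4_eq (hq : ‖q‖ < 1) (hq0 : q ≠ 0) :
    S q * Y q * H (q ^ 12) * G (q ^ 24) - q ^ 2 * T q * Z q * G (q ^ 12) * H (q ^ 24) =
      -(3 * q ^ 4) * prodVal q listNum4 := by
  have h : prodVal q (listT ++ listZ ++ listG 12 ++ listH 24) -
        prodVal q (listS ++ listY ++ listH 12 ++ listG 24) =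
      sgn true * q ^ 1 * prodVal q listNum4 :=
    prodVal_quartic_diff hq hq0 120 false true (k := 10) (d := 7) (by norm_num) (by norm_num)
      (by norm_num) (by norm_num) (by norm_num) (by decide +kernel)
  simp only [prodVal_append, sgn, if_true] at h
  simp only [S_eq hq hq0, Y_eq hq hq0, T_eq hq hq0, Z_eq hq hq0, 
    G_pow hq hq0, H_pow hq hq0, ne_eq, OfNat.ofNat_ne_zero, not_false_eq_true]
  linear_combination (3 * q ^ 3) * h

/-- The product in the denominator of the fourth quotient, up to a monomial. -/
def listDen4 : ProdList := (listT ++ listZ ++ listH 6 ++ listG 24) ++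
  (quarticList false 30 12 6 20 ++ recip (quarticList true 30 13 7 18))

lemma den4_eq (hq : ‖q‖ < 1) (hq0 : q ≠ 0) :
    T q * Z q * H (q ^ 6) * G (q ^ 24) - q ^ 4 * S q * Y q * G (q ^ 6) * H (q ^ 24) =
      -(3 * q) * prodVal q listDen4 := by
  have h : prodVal q (listT ++ listZ ++ listH 6 ++ listG 24) - sgn false * q ^ 6 * prodVal q 
        (listS ++ listY ++ listG 6 ++ listH 24) =
      prodVal q listDen4 :=
    prodVal_quartic_sub hq hq0 120 true false (k := 6) (d := 7) (by norm_num) (by norm_num)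
      (by norm_num) (by norm_num) (by norm_num) (by decide +kernel)
  simp only [prodVal_append, sgn, Bool.false_eq_true, if_false] at h
  simp only [T_eq hq hq0, Z_eq hq hq0, S_eq hq hq0, Y_eq hq hq0, 
    G_pow hq hq0, H_pow hq hq0, ne_eq, OfNat.ofNat_ne_zero, not_false_eq_true]
  linear_combination -(3 * q) * h

end Quotients

/-! ### Ratios of products and the quotients V/U, W/X, Y/Z -/

section Ratios

variable {q : ℂ}

lemma prodVal_div_eq (hq : ‖q‖ < 1) (M : ℕ) {A B C D : ProdList}
    (h : sameProd M (B ++ C) (D ++ A) = true) (hD : isAdmissible M D = true) :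
    prodVal q A / prodVal q B = prodVal q C / prodVal q D := by
  have hB := prodVal_ne_zero_of_append hq h
  have hD := prodVal_ne_zero hq hD
  have h2 := prodVal_congr hq M h
  rw [prodVal_append, prodVal_append] at h2
  rw [div_eq_div_iff hB hD]
  linear_combination -h2

lemma chi_ratio (hq : ‖q‖ < 1) :
    chi (q ^ 5) * chi (-q ^ 10) / (chi (-q ^ 6) * chi (q ^ 15)) =
      prodVal q (listChi 5 ++ listChiNeg 10) / prodVal q (listChiNeg 6 ++ listChi 15) := by
  rw [chi_pow hq (by norm_num), chi_pow hq (by norm_num), chi_neg_pow, chi_neg_pow,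
    prodVal_append, prodVal_append]

lemma chi_ratio' (hq : ‖q‖ < 1) :
    chi (q ^ 10) * chi (-q ^ 12) * chi (-q ^ 20) * chi (-q ^ 30) / chi (-q ^ 60) ^ 3 =
      prodVal q (listChi 10 ++ listChiNeg 12 ++ listChiNeg 20 ++ listChiNeg 30) /
        prodVal q (cube (listChiNeg 60)) := by
  rw [chi_pow hq (by norm_num), chi_neg_pow, chi_neg_pow, chi_neg_pow, chi_neg_pow,
    prodVal_append, prodVal_append, prodVal_append, prodVal_cube]

lemma V_mul (hq : ‖q‖ < 1) (hq0 : q ≠ 0) :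
    V q * (G q * G (q ^ 3) * H (q ^ 2) ^ 2 * H (q ^ 6)) =
      U q * (H q * H (q ^ 3) * G (q ^ 2) ^ 2 * G (q ^ 6)) := by
  have h := prodVal_congr hq 30
    (l := listV ++ (listG 1 ++ listG 3 ++ square (listH 2) ++ listH 6))
    (l' := listU ++ (listH 1 ++ listH 3 ++ square (listG 2) ++ listG 6)) (by decide +kernel)
  simp only [prodVal_append, prodVal_square] at h
  simp only [U_eq hq hq0, V_eq hq hq0, G_one hq hq0, H_one hq hq0, G_pow hq hq0, H_pow hq hq0,
    ne_eq, OfNat.ofNat_ne_zero, not_false_eq_true]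
  linear_combination (3 * q) * h

/-- The monomials 3q³ of W and 3q of X leave the factor q²; the rest is a comparison of products. -/
lemma W_mul (hq : ‖q‖ < 1) (hq0 : q ≠ 0) :
    W q * (G q ^ 2 * G (q ^ 2) * G (q ^ 3) * G (q ^ 6)) =
      q ^ 2 * X q * (H q ^ 2 * H (q ^ 2) * H (q ^ 3) * H (q ^ 6)) := by
  have h := prodVal_congr hq 30
    (l := listW ++ (square (listG 1) ++ listG 2 ++ listG 3 ++ listG 6))
    (l' := listX ++ (square (listH 1) ++ listH 2 ++ listH 3 ++ listH 6)) (by decide +kernel)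
  simp only [prodVal_append, prodVal_square] at h
  simp only [W_eq hq hq0, X_eq hq hq0, G_one hq hq0, H_one hq hq0, G_pow hq hq0, H_pow hq hq0,
    ne_eq, OfNat.ofNat_ne_zero, not_false_eq_true]
  linear_combination (3 * q ^ 3) * h

lemma Y_mul (hq : ‖q‖ < 1) (hq0 : q ≠ 0) :
    Y q * (G q * H (q ^ 2) * H (q ^ 4)) = q ^ 2 * Z q * (H q * G (q ^ 2) * G (q ^ 4)) := by
  have h := prodVal_congr hq 60 (l := listY ++ (listG 1 ++ listH 2 ++ listH 4))
    (l' := listZ ++ (listH 1 ++ listG 2 ++ listG 4)) (by decide +kernel)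
  simp only [prodVal_append] at h
  simp only [Y_eq hq hq0, Z_eq hq hq0, G_one hq hq0, H_one hq hq0, G_pow hq hq0, H_pow hq hq0,
    ne_eq, OfNat.ofNat_ne_zero, not_false_eq_true]
  linear_combination -(3 * q ^ 3) * h

end Ratios

end RogersRamanujan

end

/-! ### Assembly of the theorem -/

open RogersRamanujan in
/-- For every complex `q` with `|q| < 1` and every value `t` of `q^{1/5}`. The first two
conjuncts say that the continued fraction converges, at `q` and so at every `q^n`, to a nonzero
value; then follow the seven identities, each with the nonvanishing of its left denominator;
the last six, whose left sides are `0/0` at `q = 0`, are for `q ≠ 0`. -/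
theorem theorem1p4 (q t : ℂ) (hq : ‖q‖ < 1) (ht : t ^ 5 = q) :
    (Tendsto (contFrac q).convs atTop (𝓝 (contFracValue q)) ∧ contFracValue q ≠ 0) ∧
    (G q * G (q ^ 3) * H (q ^ 6) * G (q ^ 12)
        + q ^ 2 * H q * H (q ^ 3) * G (q ^ 6) * H (q ^ 12) ≠ 0 ∧
      (H q * H (q ^ 3) ^ 2 * G (q ^ 12) + q * G q * G (q ^ 3) ^ 2 * H (q ^ 12)) /
        (G q * G (q ^ 3) * H (q ^ 6) * G (q ^ 12)
          + q ^ 2 * H q * H (q ^ 3) * G (q ^ 6) * H (q ^ 12))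
        = chi (q ^ 5) * chi (-q ^ 10) / (chi (-q ^ 6) * chi (q ^ 15))) ∧
    (q ≠ 0 →
    (V q * H (q ^ 2) * H (q ^ 6) * G (q ^ 12)
        - q ^ 2 * U q * G (q ^ 2) * G (q ^ 6) * H (q ^ 12) ≠ 0 ∧
      (U q * G (q ^ 2) * H (q ^ 3) * G (q ^ 12)
          - q * V q * H (q ^ 2) * G (q ^ 3) * H (q ^ 12)) /
        (V q * H (q ^ 2) * H (q ^ 6) * G (q ^ 12)
          - q ^ 2 * U q * G (q ^ 2) * G (q ^ 6) * H (q ^ 12))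
        = chi (q ^ 5) * chi (-q ^ 10) / (chi (-q ^ 6) * chi (q ^ 15))) ∧
    (q ^ 4 * W q * G q * G (q ^ 6) * H (q ^ 24)
        - X q * H q * H (q ^ 6) * G (q ^ 24) ≠ 0 ∧
      (W q * G q * H (q ^ 12) * G (q ^ 24)
          - q ^ 2 * X q * H q * G (q ^ 12) * H (q ^ 24)) /
        (q ^ 4 * W q * G q * G (q ^ 6) * H (q ^ 24)
          - X q * H q * H (q ^ 6) * G (q ^ 24))
        = q ^ 3 * (chi (q ^ 10) * chi (-q ^ 12) * chi (-q ^ 20) * chi (-q ^ 30)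
            / chi (-q ^ 60) ^ 3)) ∧
    (T q * Z q * H (q ^ 6) * G (q ^ 24)
        - q ^ 4 * S q * Y q * G (q ^ 6) * H (q ^ 24) ≠ 0 ∧
      (S q * Y q * H (q ^ 12) * G (q ^ 24)
          - q ^ 2 * T q * Z q * G (q ^ 12) * H (q ^ 24)) /
        (T q * Z q * H (q ^ 6) * G (q ^ 24)
          - q ^ 4 * S q * Y q * G (q ^ 6) * H (q ^ 24))
        = q ^ 3 * (chi (q ^ 10) * chi (-q ^ 12) * chi (-q ^ 20) * chi (-q ^ 30)
            / chi (-q ^ 60) ^ 3)) ∧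
    (U q ≠ 0 ∧
      V q / (t ^ 6 * U q) = R t * R (t ^ 3) / (R (t ^ 2) ^ 2 * R (t ^ 6))) ∧
    (X q ≠ 0 ∧
      t ^ 3 * W q / X q = R t ^ 2 * R (t ^ 2) * R (t ^ 3) * R (t ^ 6)) ∧
    (Z q ≠ 0 ∧
      Y q / (q ^ 3 * Z q) = R t / (R (t ^ 2) * R (t ^ 4)))) := by
  have hGq := G_ne_zero hq
  have hHq := H_ne_zero hq
  have hcf : contFracValue q = H q / G q := contFracValue_eq hq hGq
  refine ⟨⟨hcf ▸ tendsto_contFrac hq hGq, hcf ▸ div_ne_zero hHq hGq⟩, ?_, fun hq0 => ?_⟩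
  -- The product forms require q ≠ 0; at q = 0 the functions G, H and χ all equal 1.
  · rcases eq_or_ne q 0 with rfl | hq0
    · simp [G_zero, H_zero, chi_zero]
    · rw [num1_eq hq hq0, den1_eq hq hq0, chi_ratio hq]
      exact ⟨prodVal_ne_zero (M := 60) hq (by decide +kernel),
        prodVal_div_eq hq 60 (by decide +kernel) (by decide +kernel)⟩
  have h3 : (3 : ℂ) ≠ 0 := by norm_num
  have ht0 : t ≠ 0 := by
    rintro rfl
    exact hq0 (by simpa using ht.symm)
  have hG : ∀ {k : ℕ}, k ≠ 0 → G (q ^ k) ≠ 0 := fun hk => G_ne_zero (norm_pow_lt_one hq hk)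
  have hH : ∀ {k : ℕ}, k ≠ 0 → H (q ^ k) ≠ 0 := fun hk => H_ne_zero (norm_pow_lt_one hq hk)
  have hG2 := hG two_ne_zero
  have hG3 := hG three_ne_zero
  have hG4 := hG four_ne_zero
  have hG6 := hG (k := 6) (by norm_num)
  have hH2 := hH two_ne_zero
  have hH3 := hH three_ne_zero
  have hH4 := hH four_ne_zero
  have hH6 := hH (k := 6) (by norm_num)
  have hR1 : R t = t * (H q / G q) := by simpa using R_pow hq ht one_ne_zero
  have hU : U q ≠ 0 := by
    rw [U_eq hq hq0]
    exact mul_ne_zero (mul_ne_zero h3 hq0) (prodVal_ne_zero (M := 30) hq (by decide +kernel))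
  have hX : X q ≠ 0 := by
    rw [X_eq hq hq0]
    exact mul_ne_zero (mul_ne_zero h3 hq0) (prodVal_ne_zero (M := 30) hq (by decide +kernel))
  have hZ : Z q ≠ 0 := by
    rw [Z_eq hq hq0]
    exact mul_ne_zero (neg_ne_zero.2 (mul_ne_zero h3 hq0))
      (prodVal_ne_zero (M := 60) hq (by decide +kernel))
  have hV := V_mul hq hq0
  have hW := W_mul hq hq0
  have hY := Y_mul hq hq0
  refine ⟨?_, ?_, ?_, ⟨hU, ?_⟩, ⟨hX, ?_⟩, ⟨hZ, ?_⟩⟩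
  · have hD : prodVal q listDen2 ≠ 0 := prodVal_ne_zero (M := 60) hq (by decide +kernel)
    rw [num2_eq hq hq0, den2_eq hq hq0, chi_ratio hq]
    refine ⟨mul_ne_zero (mul_ne_zero h3 hq0) hD, ?_⟩
    rw [mul_div_mul_left _ _ (mul_ne_zero h3 hq0)]
    exact prodVal_div_eq hq 60 (by decide +kernel) (by decide +kernel)
  · have hD : prodVal q listDen3 ≠ 0 := prodVal_ne_zero (M := 120) hq (by decide +kernel)
    rw [num3_eq hq hq0, den3_eq hq hq0, chi_ratio' hq,
      ← prodVal_div_eq hq 120 (A := listNum3) (B := listDen3) (by decide +kernel)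
        (by decide +kernel)]
    refine ⟨mul_ne_zero (neg_ne_zero.2 (mul_ne_zero h3 hq0)) hD, ?_⟩
    field_simp
  · have hD : prodVal q listDen4 ≠ 0 := prodVal_ne_zero (M := 120) hq (by decide +kernel)
    rw [num4_eq hq hq0, den4_eq hq hq0, chi_ratio' hq,
      ← prodVal_div_eq hq 120 (A := listNum4) (B := listDen4) (by decide +kernel)
        (by decide +kernel)]
    refine ⟨mul_ne_zero (neg_ne_zero.2 (mul_ne_zero h3 hq0)) hD, ?_⟩
    field_simp
  · rw [hR1, R_pow hq ht three_ne_zero, R_pow hq ht two_ne_zero,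
      R_pow hq ht (k := 6) (by norm_num)]
    field_simp
    linear_combination hV
  · rw [hR1, R_pow hq ht three_ne_zero, R_pow hq ht two_ne_zero,
      R_pow hq ht (k := 6) (by norm_num)]
    -- The powers of t balance: t³ · q² = t¹³, and 2·1 + 2 + 3 + 6 = 13 on the right.
    have hq2 : q ^ 2 = t ^ 10 := by rw [← ht]; ring
    field_simp
    linear_combination hW + X q * (H q ^ 2 * H (q ^ 2) * H (q ^ 3) * H (q ^ 6)) * hq2
  · rw [hR1, R_pow hq ht two_ne_zero, R_pow hq ht four_ne_zero]
    field_simp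
    rw [← ht] at hY ⊢
    linear_combination t ^ 5 * hY
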